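/- **Theorem 1.** Let $(\varepsilon_i)_{i\in\mathbb Z}$ be i.i.d. real random variables with mean $0$ and variance $\sigma^2\in(0,\infty)$ (with $\sigma>0$), let $(a_i)_{i\ge 0}$ be a square-summable real sequence, and let $$X_t=\sum_{i=0}^\infty a_i\,\varepsilon_{t-i},\qquad t\ge 1,$$ the series converging in mean square; put $S_n=X_1+\cdots+X_n$. Assume that one of the following holds: * (short memory) $d=0$ and $\sum_{i\ge0}|a_i|<\infty$; or * (long memory) $0<d<1/2$ and, for some constant $c(d)>0$, $a_i\sim c(d)\,i^{d-1}$ as $i\to\infty$. Let $$m(d)=\begin{cases}\sum_{i=0}^\infty a_i, & d=0,\\[2pt] c(d)/d, & 0<d<1/2,\end{cases}\qquad I_r(d)=\frac1{1+rd}+\int_0^\infty\big((1+x)^d-x^d\big)^r\,dx\quad(r=2,3).$$ Let $k\ge0$ be an integer with $\mathbb E|\varepsilon_1|^k<\infty$. Then the integrals in $I_2(d)$ and $I_3(d)$ converge, $\mathbb E|S_n|^k<\infty$ for all $n$, and as $n\to\infty$: * if $k=2p$ with an integer $p\ge0$, then $$n^{-p(1+2d)}\,\mathbb E[S_n^k]\;\longrightarrow\;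 m(d)^k\,\sigma^k\,\frac{k!}{2^p\,p!}\,I_2(d)^p;$$ * if $k=3+2\ell$ with an integer $\ell\ge0$, then, with $\eta=\mathbb E[\varepsilon_1^3]$, $$\sqrt n\;n^{-\frac k2(1+2d)}\,\mathbb E[S_n^k]\;\longrightarrow\; m(d)^k\,\eta\,\sigma^{k-3}\binom{3+2\ell}{3}\frac{(2\ell)!}{2^\ell\,\ell!}\;I_3(d)\,I_2(d)^\ell.$$ -/

import Mathlib

open MeasureTheory ProbabilityTheory Filter Topology Asymptotics
open scoped ENNReal

/-- `ε` is an i.i.d. (two-sided) white noise: independent, identically distributed, centred,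
square integrable random variables with variance `σ ^ 2`, where `σ > 0`. -/
structure IsIIDWhiteNoise {Ω : Type*} [MeasurableSpace Ω] (P : Measure Ω)
    (ε : ℤ → Ω → ℝ) (σ : ℝ) : Prop where
  measurable : ∀ i, Measurable (ε i)
  indep : iIndepFun ε P
  identDistrib : ∀ i, IdentDistrib (ε i) (ε 1) P P
  memLp_two : MemLp (ε 1) 2 P
  mean_zero : ∫ ω, ε 1 ω ∂P = 0
  sigma_pos : 0 < σ
  variance_eq : variance (ε 1) P = σ ^ 2

/-- `X` is the (centred) linear process `X t = ∑_{i ≥ 0} a i * ε (t - i)`, `t ≥ 1`, with square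
summable coefficients, the series converging in mean square. (The series is in general not
absolutely convergent, so a pointwise `tsum` would not do.) -/
structure IsLinearProcess {Ω : Type*} [MeasurableSpace Ω] (P : Measure Ω)
    (a : ℕ → ℝ) (ε : ℤ → Ω → ℝ) (X : ℕ → Ω → ℝ) : Prop where
  summable_sq : Summable (fun i => a i ^ 2)
  memLp_two : ∀ t, 1 ≤ t → MemLp (X t) 2 P
  tendsto_partial : ∀ t, 1 ≤ t →
    Tendsto (fun N : ℕ => eLpNorm
      (fun ω => X t ω - ∑ i ∈ Finset.range N, a i * ε ((t : ℤ) - (i : ℤ)) ω) 2 P) atTop (𝓝 0)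

/-- The coefficients `a` have memory parameter `d`: short memory (`d = 0`, absolutely summable
coefficients) or long memory (`0 < d < 1/2` and `a i ∼ c * i ^ (d - 1)` with `c > 0`).
The constant `c` plays no role when `d = 0`. -/
def HasMemory (a : ℕ → ℝ) (d c : ℝ) : Prop :=
  (d = 0 ∧ Summable (fun i => |a i|)) ∨
  (0 < d ∧ d < 1 / 2 ∧ 0 < c ∧ a ~[atTop] (fun i : ℕ => c * (i : ℝ) ^ (d - 1)))

open Classical in
/-- The constant `m(d)`: the sum of the coefficients if `d = 0`, and `c / d` otherwise. -/
noncomputable def memoryConst (a : ℕ → ℝ) (d c : ℝ) : ℝ :=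
  if d = 0 then ∑' i, a i else c / d

/-- The partial sum `S_n = X_1 + ⋯ + X_n`. -/
def partialSum {Ω : Type*} (X : ℕ → Ω → ℝ) (n : ℕ) (ω : Ω) : ℝ :=
  ∑ t ∈ Finset.Icc 1 n, X t ω

/-- The factor `1 / (1 + r d) + ∫_0^∞ ((1 + x)^d - x^d)^r dx`. -/
noncomputable def integralFactor (d : ℝ) (r : ℕ) : ℝ :=
  1 / (1 + r * d) + ∫ x in Set.Ioi (0 : ℝ), ((1 + x) ^ d - x ^ d) ^ r

/-!
The partial sum `S_n` is a linear combination `∑ N, windowSum a n N * ε (n - N)` of i.i.d.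
variables, so its cumulant of order `r` is that of the noise times the power sum
`∑ N, windowSum a n N ^ r`. Two things have to be understood: how moments follow from power sums,
and how the power sums grow.

*Moments from power sums.* For finite linear combinations the exponential generating series of the
moments is the product of the rescaled series of the noise; differentiating it formally gives the
recursion `moment_linearComb_recursion`, in which only moments of order at most `k` occur, so that
no moment generating function has to exist. The recursion passes to `S_n` itself
(`partialSum_moment_recursion`) because the series of the `X t` converge in `L^k`. This is
delicate for odd `k`, where absolute moments are not moments; it rests on the Rosenthal-type
inequality `exists_moment_bound`, and the limit is taken by Fatou's lemma along an almost surely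
convergent subsequence.

*Growth of power sums.* The sums of the first `n` coefficients behave like `m(d) * n ^ d`
in both regimes. Noise variables inside the observation window contribute a Cesàro mean, which
gives `1 / (1 + r d)`. Those before it contribute, under long memory, a Riemann sum which converges
by domination to the integral of `((1 + x) ^ d - x ^ d) ^ r`; under short memory their contribution
is negligible. So the power sum of order `r ≥ 2`, divided by `n ^ (1 + r d)`, tends to
`m(d) ^ r * I_r(d)` (`tendsto_powerSum_div_rpow`).

After division by `n ^ (1 / 2 + d)`, the cumulant of order `r` is thus `O(n ^ (1 - r / 2))`.
In the recursion only the second cumulant survives for even orders, which yields the moments of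
a normal law (`tendsto_of_recursion`). For odd orders exactly one third cumulant enters, at
the scale `n ^ (-1 / 2)`, combined with second ones (`tendsto_mul_odd_of_recursion`).
-/

/-! ### Moment generating series and the cumulant recursion -/

/-- The formal exponential generating series `∑ μ r / r! * X ^ r` of a sequence of moments. -/
noncomputable def momentSeries (μ : ℕ → ℝ) : PowerSeries ℝ :=
  PowerSeries.mk fun r => μ r / (r.factorial : ℝ)

/-- The coefficients of the logarithmic derivative `M' / M` of the moment series `M`. When `μ` is
the moment sequence of a random variable, `logDerivCoeff μ r` is its cumulant of order `r + 1`
divided by `r!`. -/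
noncomputable def logDerivCoeff (μ : ℕ → ℝ) (r : ℕ) : ℝ :=
  PowerSeries.coeff r (PowerSeries.derivative ℝ (momentSeries μ) * (momentSeries μ)⁻¹)

theorem derivative_momentSeries (μ : ℕ → ℝ) :
    PowerSeries.derivative ℝ (momentSeries μ)
      = PowerSeries.mk fun r => μ (r + 1) / (r.factorial : ℝ) := by
  ext r
  rw [PowerSeries.coeff_derivative, momentSeries, PowerSeries.coeff_mk, PowerSeries.coeff_mk,
    Nat.factorial_succ]
  have : (r.factorial : ℝ) ≠ 0 := by positivity
  push_cast
  field_simp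

theorem derivative_momentSeries_eq_mul (μ : ℕ → ℝ) (h0 : μ 0 = 1) :
    PowerSeries.derivative ℝ (momentSeries μ)
      = PowerSeries.mk (logDerivCoeff μ) * momentSeries μ := by
  have hc : PowerSeries.constantCoeff (momentSeries μ) ≠ 0 := by
    rw [← PowerSeries.coeff_zero_eq_constantCoeff_apply, momentSeries, PowerSeries.coeff_mk]
    simp [h0]
  have : PowerSeries.mk (logDerivCoeff μ)
      = PowerSeries.derivative ℝ (momentSeries μ) * (momentSeries μ)⁻¹ := by
    ext r; rw [PowerSeries.coeff_mk, logDerivCoeff]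
  rw [this, mul_assoc, PowerSeries.inv_mul_cancel _ hc, mul_one]

theorem moment_succ_eq_sum (μ : ℕ → ℝ) (h0 : μ 0 = 1) (j : ℕ) :
    μ (j + 1) / (j.factorial : ℝ) =
      ∑ x ∈ Finset.HasAntidiagonal.antidiagonal j,
        logDerivCoeff μ x.1 * (μ x.2 / (x.2.factorial : ℝ)) := by
  have h := congrArg (PowerSeries.coeff j) (derivative_momentSeries_eq_mul μ h0)
  rw [derivative_momentSeries, PowerSeries.coeff_mk, PowerSeries.coeff_mul] at h
  simpa [momentSeries] using h

theorem logDerivCoeff_zero (μ : ℕ → ℝ) (h0 : μ 0 = 1) : logDerivCoeff μ 0 = μ 1 := by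
  have := moment_succ_eq_sum μ h0 0
  simp [h0] at this
  exact this.symm

theorem logDerivCoeff_one (μ : ℕ → ℝ) (h0 : μ 0 = 1) (h1 : μ 1 = 0) :
    logDerivCoeff μ 1 = μ 2 := by
  have := moment_succ_eq_sum μ h0 1
  rw [Finset.Nat.sum_antidiagonal_eq_sum_range_succ_mk] at this
  simp [Finset.sum_range_succ, h0, h1] at this
  exact this.symm

theorem logDerivCoeff_two (μ : ℕ → ℝ) (h0 : μ 0 = 1) (h1 : μ 1 = 0) :
    logDerivCoeff μ 2 = μ 3 / 2 := by
  have := moment_succ_eq_sum μ h0 2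
  have h2 := logDerivCoeff_zero μ h0
  rw [Finset.Nat.sum_antidiagonal_eq_sum_range_succ_mk] at this
  simp [Finset.sum_range_succ, h0, h1, h2] at this
  exact this.symm

/-- Logarithmic derivatives of power series add up along products; here for products of
rescalings of one series, where the sum of the logarithmic derivatives has the power sums of the
scaling factors in its coefficients. -/
theorem derivative_prod_rescale {ι : Type*} (μ : ℕ → ℝ) (h0 : μ 0 = 1) (F : Finset ι)
    (b : ι → ℝ) :
    PowerSeries.derivative ℝ (∏ i ∈ F, PowerSeries.rescale (b i) (momentSeries μ))
      = (PowerSeries.mk fun r => logDerivCoeff μ r * ∑ i ∈ F, b i ^ (r + 1))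
        * ∏ i ∈ F, PowerSeries.rescale (b i) (momentSeries μ) := by
  classical
  induction F using Finset.induction_on with
  | empty =>
    ext n
    simp
  | insert i F hi ih =>
    rw [Finset.prod_insert hi, Derivation.leibniz, ih, smul_eq_mul, smul_eq_mul]
    have h1 : PowerSeries.derivative ℝ (PowerSeries.rescale (b i) (momentSeries μ))
        = (PowerSeries.mk fun r => logDerivCoeff μ r * b i ^ (r + 1))
          * PowerSeries.rescale (b i) (momentSeries μ) := by
      have h2 : PowerSeries.derivative ℝ (PowerSeries.rescale (b i) (momentSeries μ))
          = PowerSeries.C (b i)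
            * PowerSeries.rescale (b i) (PowerSeries.derivative ℝ (momentSeries μ)) := by
        ext n
        simp only [PowerSeries.coeff_derivative, PowerSeries.coeff_rescale,
          PowerSeries.coeff_C_mul]
        ring
      rw [h2, derivative_momentSeries_eq_mul μ h0, map_mul, ← mul_assoc]
      congr 1
      ext n
      simp only [PowerSeries.coeff_rescale, PowerSeries.coeff_C_mul, PowerSeries.coeff_mk]
      ring
    rw [h1]
    have h3 : (PowerSeries.mk fun r => logDerivCoeff μ r * ∑ j ∈ insert i F, b j ^ (r + 1))
        = (PowerSeries.mk fun r => logDerivCoeff μ r * b i ^ (r + 1))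
          + PowerSeries.mk fun r => logDerivCoeff μ r * ∑ j ∈ F, b j ^ (r + 1) := by
      ext n
      simp only [PowerSeries.coeff_mk, map_add, Finset.sum_insert hi, mul_add]
    rw [h3]
    ring

section Moments

variable {Ω : Type*} [MeasurableSpace Ω] {P : Measure Ω}

theorem integrable_pow_of_memLp [IsProbabilityMeasure P] {f : Ω → ℝ} {K : ℕ}
    (hf : MemLp f (K : ℝ≥0∞) P) {r : ℕ} (hr : r ≤ K) : Integrable (fun ω => f ω ^ r) P := by
  have h : MemLp f (r : ℝ≥0∞) P := hf.mono_exponent (by exact_mod_cast hr)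
  refine h.integrable_norm_pow'.mono' (h.1.pow r) (ae_of_all _ fun ω => ?_)
  simp

theorem integrable_abs_pow_of_memLp [IsProbabilityMeasure P] {f : Ω → ℝ} {K : ℕ}
    (hf : MemLp f (K : ℝ≥0∞) P) {r : ℕ} (hr : r ≤ K) : Integrable (fun ω => |f ω| ^ r) P := by
  have h : MemLp f (r : ℝ≥0∞) P := hf.mono_exponent (by exact_mod_cast hr)
  simpa using h.integrable_norm_pow'

variable {ι : Type*} {ξ : ι → Ω → ℝ} {ζ : Ω → ℝ}

theorem memLp_linearComb (hid : ∀ i, IdentDistrib (ξ i) ζ P P) {K : ℕ}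
    (hK : MemLp ζ (K : ℝ≥0∞) P) (F : Finset ι) (b : ι → ℝ) :
    MemLp (fun ω => ∑ i ∈ F, b i * ξ i ω) (K : ℝ≥0∞) P :=
  memLp_finsetSum F fun i _ => ((hid i).memLp_iff.mpr hK).const_mul (b i)

theorem integral_pow_eq_of_identDistrib {X Y : Ω → ℝ} (h : IdentDistrib X Y P P) (r : ℕ) :
    ∫ ω, X ω ^ r ∂P = ∫ ω, Y ω ^ r ∂P :=
  (h.comp (measurable_id.pow_const r)).integral_eq

theorem indepFun_linearComb (hm : ∀ i, Measurable (ξ i)) (hi : iIndepFun ξ P) (b : ι → ℝ)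
    {F : Finset ι} {i : ι} (hiF : i ∉ F) :
    IndepFun (fun ω => ∑ j ∈ F, b j * ξ j ω) (ξ i) P := by
  classical
  have h := hi.indepFun_finset (S := F) (T := {i}) (by simpa using hiF) hm
  have hψ : Measurable fun x : ({i} : Finset ι) → ℝ => x ⟨i, by simp⟩ := measurable_pi_apply _
  have := h.comp (φ := fun x : F → ℝ => ∑ j : F, b j * x j)
    (by fun_prop) hψ
  convert this using 1
  · ext ω
    simp only [Function.comp]
    rw [← Finset.sum_coe_sort F]
  · rfl

/-- The moments of a finite linear combination of i.i.d. variables are the coefficients of the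
product of the rescaled moment series, up to the order to which moments exist. -/
theorem moment_linearComb_eq_coeff [IsProbabilityMeasure P]
    (hm : ∀ i, Measurable (ξ i)) (hi : iIndepFun ξ P)
    (hid : ∀ i, IdentDistrib (ξ i) ζ P P) {K : ℕ} (hK : MemLp ζ (K : ℝ≥0∞) P)
    (F : Finset ι) (b : ι → ℝ) {r : ℕ} (hr : r ≤ K) :
    (∫ ω, (∑ i ∈ F, b i * ξ i ω) ^ r ∂P) / (r.factorial : ℝ) =
      PowerSeries.coeff r (∏ i ∈ F,
        PowerSeries.rescale (b i) (momentSeries fun s => ∫ ω, ζ ω ^ s ∂P)) := by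
  classical
  induction F using Finset.induction_on generalizing r with
  | empty => cases r <;> simp [PowerSeries.coeff_one]
  | insert i F hiF ih =>
    rw [Finset.prod_insert hiF, PowerSeries.coeff_mul]
    have hS := memLp_linearComb (b := b) hid hK F
    have hx : MemLp (ξ i) (K : ℝ≥0∞) P := (hid i).memLp_iff.mpr hK
    have hind := indepFun_linearComb hm hi b hiF
    have hterm : ∀ x ∈ Finset.HasAntidiagonal.antidiagonal r, ∀ c : ℝ,
        Integrable (fun ω => c * (ξ i ω ^ x.1 * (∑ j ∈ F, b j * ξ j ω) ^ x.2)) P ∧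
        ∫ ω, c * (ξ i ω ^ x.1 * (∑ j ∈ F, b j * ξ j ω) ^ x.2) ∂P =
          c * ((∫ ω, ζ ω ^ x.1 ∂P) * ∫ ω, (∑ j ∈ F, b j * ξ j ω) ^ x.2 ∂P) := by
      intro x hx' c
      rw [Finset.HasAntidiagonal.mem_antidiagonal] at hx'
      have hc : IndepFun (fun ω => ξ i ω ^ x.1) (fun ω => (∑ j ∈ F, b j * ξ j ω) ^ x.2) P :=
        hind.symm.comp (measurable_id.pow_const x.1) (measurable_id.pow_const x.2)
      have i1 := integrable_pow_of_memLp hx (r := x.1) (by omega)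
      have i2 := integrable_pow_of_memLp hS (r := x.2) (by omega)
      refine ⟨(hc.integrable_mul i1 i2).const_mul c, ?_⟩
      rw [integral_const_mul, ← integral_pow_eq_of_identDistrib (hid i)]
      congr 1
      exact hc.integral_fun_mul_eq_mul_integral i1.1 i2.1
    have hexp : ∀ ω, (∑ j ∈ insert i F, b j * ξ j ω) ^ r =
        ∑ x ∈ Finset.HasAntidiagonal.antidiagonal r, (r.choose x.1 * b i ^ x.1 : ℝ) *
          (ξ i ω ^ x.1 * (∑ j ∈ F, b j * ξ j ω) ^ x.2) := by
      intro ω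
      rw [Finset.sum_insert hiF, (Commute.all _ _).add_pow']
      refine Finset.sum_congr rfl fun x _ => ?_
      rw [nsmul_eq_mul, mul_pow]
      ring
    simp_rw [hexp]
    rw [integral_finsetSum _ fun x hx' => (hterm x hx' _).1, Finset.sum_div]
    refine Finset.sum_congr rfl fun x hx' => ?_
    rw [(hterm x hx' _).2]
    rw [Finset.HasAntidiagonal.mem_antidiagonal] at hx'
    rw [← ih (r := x.2) (by omega), PowerSeries.coeff_rescale, momentSeries, PowerSeries.coeff_mk]
    subst hx'
    rw [Nat.cast_add_choose]
    field_simp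

/-- The recursion between moments and cumulants of a finite linear combination of i.i.d.
variables: only the power sums of the coefficients enter. -/
theorem moment_linearComb_recursion [IsProbabilityMeasure P]
    (hm : ∀ i, Measurable (ξ i)) (hi : iIndepFun ξ P)
    (hid : ∀ i, IdentDistrib (ξ i) ζ P P) {K : ℕ} (hK : MemLp ζ (K : ℝ≥0∞) P)
    (F : Finset ι) (b : ι → ℝ) {j : ℕ} (hj : j + 1 ≤ K) :
    ((j : ℝ) + 1) * ((∫ ω, (∑ i ∈ F, b i * ξ i ω) ^ (j + 1) ∂P) / ((j + 1).factorial : ℝ)) =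
      ∑ r ∈ Finset.range (j + 1), (logDerivCoeff (fun s => ∫ ω, ζ ω ^ s ∂P) r
        * ∑ i ∈ F, b i ^ (r + 1))
        * ((∫ ω, (∑ i ∈ F, b i * ξ i ω) ^ (j - r) ∂P) / ((j - r).factorial : ℝ)) := by
  have h := congrArg (PowerSeries.coeff j) (derivative_prod_rescale (fun s => ∫ ω, ζ ω ^ s ∂P)
    (by simp) F b)
  rw [PowerSeries.coeff_derivative, ← moment_linearComb_eq_coeff hm hi hid hK F b hj,
    PowerSeries.coeff_mul, Finset.Nat.sum_antidiagonal_eq_sum_range_succ_mk] at h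
  rw [mul_comm, h]
  refine Finset.sum_congr rfl fun r hr => ?_
  rw [PowerSeries.coeff_mk, moment_linearComb_eq_coeff hm hi hid hK F b (by omega)]

end Moments

/-! ### A moment inequality for sums of independent centred variables -/

theorem exists_abs_add_pow_sub_le (n : ℕ) : ∃ C : ℝ, 0 ≤ C ∧ ∀ x y : ℝ, 0 ≤ x → |y| ≤ x →
    |(x + y) ^ (n + 2) - x ^ (n + 2) - (n + 2) * x ^ (n + 1) * y| ≤ C * (x ^ n * y ^ 2) := by
  induction n with
  | zero =>
    refine ⟨1, zero_le_one, fun x y _ _ => le_of_eq ?_⟩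
    have : (x + y) ^ (0 + 2) - x ^ (0 + 2) - ((0 : ℕ) + 2) * x ^ (0 + 1) * y = y ^ 2 := by
      push_cast; ring
    rw [this, abs_of_nonneg (sq_nonneg y)]
    ring
  | succ n ih =>
    obtain ⟨C, hC, h⟩ := ih
    refine ⟨2 * C + (n + 2), by positivity, fun x y hx hy => ?_⟩
    have e : (x + y) ^ (n + 1 + 2) - x ^ (n + 1 + 2) - ((n + 1 : ℕ) + 2) * x ^ (n + 1 + 1) * y
        = (x + y) * ((x + y) ^ (n + 2) - x ^ (n + 2) - (n + 2) * x ^ (n + 1) * y)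
          + (n + 2) * x ^ (n + 1) * y ^ 2 := by
      push_cast; ring
    have hxy : |x + y| ≤ 2 * x := (abs_add_le x y).trans (by rw [abs_of_nonneg hx]; linarith)
    rw [e]
    refine (abs_add_le _ _).trans ?_
    rw [abs_mul, abs_of_nonneg (by positivity : 0 ≤ ((n : ℝ) + 2) * x ^ (n + 1) * y ^ 2)]
    calc _ ≤ 2 * x * (C * (x ^ n * y ^ 2)) + (n + 2) * x ^ (n + 1) * y ^ 2 := by
          gcongr
          exact h x y hx hy
      _ = _ := by ring

/-- A second order Taylor bound for `x ↦ |x| ^ (m + 2)`. The linear term is kept, as it averages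
out when `y` is centred and independent of `x`. -/
theorem exists_abs_add_pow_le (m : ℕ) : ∃ C : ℝ, 0 ≤ C ∧ ∀ x y : ℝ,
    |x + y| ^ (m + 2) ≤ |x| ^ (m + 2) + (m + 2) * (x * |x| ^ m * y)
      + C * (|x| ^ m * y ^ 2 + |y| ^ (m + 2)) := by
  obtain ⟨C, hC, h⟩ := exists_abs_add_pow_sub_le m
  refine ⟨C + 2 ^ (m + 2) + (m + 2), by positivity, fun x y => ?_⟩
  have hA : 0 ≤ |x| ^ m * y ^ 2 := by positivity
  have hB : 0 ≤ |y| ^ (m + 2) := by positivity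
  rcases le_or_gt |y| |x| with hxy | hxy
  · have key : |x + y| ^ (m + 2) ≤ |x| ^ (m + 2) + (m + 2) * (x * |x| ^ m * y)
        + C * (|x| ^ m * y ^ 2) := by
      rcases le_total 0 x with hx | hx
      · rw [abs_of_nonneg hx] at hxy ⊢
        have h1 := (abs_le.mp (h x y hx hxy)).2
        rw [abs_of_nonneg (by linarith [neg_abs_le y] : 0 ≤ x + y)]
        calc _ ≤ x ^ (m + 2) + (m + 2) * x ^ (m + 1) * y + C * (x ^ m * y ^ 2) := by linarith
          _ = _ := by ring
      · rw [abs_of_nonpos hx] at hxy ⊢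
        have h1 := (abs_le.mp (h (-x) (-y) (by linarith) (by rwa [abs_neg]))).2
        rw [abs_of_nonpos (by linarith [le_abs_self y] : x + y ≤ 0), neg_add]
        calc _ ≤ (-x) ^ (m + 2) + (m + 2) * (-x) ^ (m + 1) * (-y)
              + C * ((-x) ^ m * (-y) ^ 2) := by linarith
          _ = _ := by ring
    refine key.trans ?_
    have : 0 ≤ (2 ^ (m + 2) + (m + 2)) * (|x| ^ m * y ^ 2)
        + (C + 2 ^ (m + 2) + (m + 2)) * |y| ^ (m + 2) := by positivity
    linarith
  · have h1 : |x + y| ^ (m + 2) ≤ 2 ^ (m + 2) * |y| ^ (m + 2) := by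
      rw [← mul_pow]
      exact pow_le_pow_left₀ (abs_nonneg _) ((abs_add_le x y).trans (by linarith)) _
    have h2 : -(|y| ^ (m + 2)) ≤ x * |x| ^ m * y := by
      refine neg_le_of_abs_le ?_
      rw [abs_mul, abs_mul, abs_pow, abs_abs]
      calc |x| * |x| ^ m * |y| ≤ |y| * |y| ^ m * |y| := by gcongr
        _ = _ := by ring
    have h3 : (m + 2) * (-(|y| ^ (m + 2))) ≤ (m + 2) * (x * |x| ^ m * y) := by gcongr
    have : 0 ≤ |x| ^ (m + 2) + C * |y| ^ (m + 2)
        + (C + 2 ^ (m + 2) + (m + 2)) * (|x| ^ m * y ^ 2) := by positivity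
    linarith

section Rosenthal

variable {Ω : Type*} [MeasurableSpace Ω] {P : Measure Ω} [IsProbabilityMeasure P]
  {ι : Type*} {ξ : ι → Ω → ℝ} {ζ : Ω → ℝ}

/-- The inductive step, from order `m` to order `m + 2`, of `exists_moment_bound`: the summands are
added one by one, and each of them raises the moment by at most a multiple of `b i ^ 2 * R ^ m`. -/
theorem exists_moment_bound_step (hm : ∀ i, Measurable (ξ i)) (hi : iIndepFun ξ P)
    (hid : ∀ i, IdentDistrib (ξ i) ζ P P) {K : ℕ} (hK : MemLp ζ (K : ℝ≥0∞) P)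
    (h0 : ∫ ω, ζ ω ∂P = 0) {m : ℕ} (hmK : m + 2 ≤ K) {D : ℝ} (hD : 0 ≤ D)
    (hbound : ∀ (F : Finset ι) (b : ι → ℝ) (R : ℝ), 0 ≤ R → ∑ i ∈ F, b i ^ 2 ≤ R ^ 2 →
      ∫ ω, |∑ i ∈ F, b i * ξ i ω| ^ m ∂P ≤ D * R ^ m) :
    ∃ D' : ℝ, 0 ≤ D' ∧ ∀ (F : Finset ι) (b : ι → ℝ) (R : ℝ), 0 ≤ R →
      ∑ i ∈ F, b i ^ 2 ≤ R ^ 2 →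
      ∫ ω, |∑ i ∈ F, b i * ξ i ω| ^ (m + 2) ∂P ≤ D' * R ^ (m + 2) := by
  classical
  obtain ⟨C, hC, hTaylor⟩ := exists_abs_add_pow_le m
  set v := ∫ ω, ζ ω ^ 2 ∂P with hv
  set w := ∫ ω, |ζ ω| ^ (m + 2) ∂P with hw
  have hv0 : 0 ≤ v := integral_nonneg fun ω => sq_nonneg _
  have hw0 : 0 ≤ w := integral_nonneg fun ω => by positivity
  refine ⟨C * (D * v + w), by positivity, fun F b R hR hF => ?_⟩
  suffices H : ∫ ω, |∑ i ∈ F, b i * ξ i ω| ^ (m + 2) ∂P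
      ≤ C * (D * v + w) * R ^ m * ∑ i ∈ F, b i ^ 2 by
    refine H.trans ?_
    calc _ ≤ C * (D * v + w) * R ^ m * R ^ 2 := by gcongr
      _ = _ := by ring
  induction F using Finset.induction_on with
  | empty => simp
  | insert i F hiF ih =>
    rw [Finset.sum_insert hiF] at hF ⊢
    have hbi : b i ^ 2 ≤ R ^ 2 := by
      linarith [Finset.sum_nonneg fun j (_ : j ∈ F) => sq_nonneg (b j)]
    have hF' : ∑ j ∈ F, b j ^ 2 ≤ R ^ 2 := by linarith [sq_nonneg (b i)]
    have hS := memLp_linearComb (b := b) hid hK F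
    have hx : MemLp (ξ i) (K : ℝ≥0∞) P := (hid i).memLp_iff.mpr hK
    have hind := indepFun_linearComb hm hi b hiF
    set S : Ω → ℝ := fun ω => ∑ j ∈ F, b j * ξ j ω with hSdef
    have hSm : Measurable S := Finset.measurable_sum _ fun j _ => (hm j).const_mul _
    -- the three mixed moments, which factor by independence
    have j1 : IndepFun (fun ω => S ω * |S ω| ^ m) (ξ i) P :=
      hind.comp (φ := fun x => x * |x| ^ m) (ψ := id) (by fun_prop) measurable_id
    have a1 : Integrable (fun ω => S ω * |S ω| ^ m) P := by
      refine (integrable_abs_pow_of_memLp hS (r := m + 1) (by omega)).mono'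
        (by fun_prop) (ae_of_all _ fun ω => ?_)
      rw [Real.norm_eq_abs, abs_mul, abs_pow, abs_abs, pow_succ']
    have a1' : Integrable (ξ i) P := by
      simpa using integrable_pow_of_memLp hx (r := 1) (by omega)
    have e1 : ∫ ω, S ω * |S ω| ^ m * ξ i ω ∂P = 0 := by
      rw [j1.integral_fun_mul_eq_mul_integral a1.1 a1'.1, (hid i).integral_eq, h0, mul_zero]
    have j2 : IndepFun (fun ω => |S ω| ^ m) (fun ω => ξ i ω ^ 2) P :=
      hind.comp (φ := fun x => |x| ^ m) (ψ := fun x => x ^ 2) (by fun_prop) (by fun_prop)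
    have a2 := integrable_abs_pow_of_memLp hS (r := m) (by omega)
    have a2' := integrable_pow_of_memLp hx (r := 2) (by omega)
    have e2 : ∫ ω, |S ω| ^ m * ξ i ω ^ 2 ∂P = (∫ ω, |S ω| ^ m ∂P) * v := by
      rw [j2.integral_fun_mul_eq_mul_integral a2.1 a2'.1,
        integral_pow_eq_of_identDistrib (hid i)]
    have e3 : ∫ ω, |ξ i ω| ^ (m + 2) ∂P = w :=
      ((hid i).comp (u := fun x => |x| ^ (m + 2)) (by fun_prop)).integral_eq
    have a3 := integrable_abs_pow_of_memLp hx (r := m + 2) (by omega)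
    have a0 := integrable_abs_pow_of_memLp hS (r := m + 2) (by omega)
    have i1 : Integrable (fun ω => (m + 2) * b i * (S ω * |S ω| ^ m * ξ i ω)) P :=
      (j1.integrable_mul a1 a1').const_mul _
    have i2 : Integrable (fun ω => b i ^ 2 * (|S ω| ^ m * ξ i ω ^ 2)) P :=
      (j2.integrable_mul a2 a2').const_mul _
    have i3 : Integrable (fun ω => |b i| ^ (m + 2) * |ξ i ω| ^ (m + 2)) P := a3.const_mul _
    have i23 : Integrable (fun ω => C * (b i ^ 2 * (|S ω| ^ m * ξ i ω ^ 2)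
        + |b i| ^ (m + 2) * |ξ i ω| ^ (m + 2))) P := (i2.add i3).const_mul C
    have i01 : Integrable (fun ω => |S ω| ^ (m + 2)
        + (m + 2) * b i * (S ω * |S ω| ^ m * ξ i ω)) P := a0.add i1
    have hle : ∫ ω, |∑ j ∈ insert i F, b j * ξ j ω| ^ (m + 2) ∂P ≤
        ∫ ω, (|S ω| ^ (m + 2) + (m + 2) * b i * (S ω * |S ω| ^ m * ξ i ω)
          + C * (b i ^ 2 * (|S ω| ^ m * ξ i ω ^ 2)
            + |b i| ^ (m + 2) * |ξ i ω| ^ (m + 2))) ∂P := by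
      refine integral_mono (integrable_abs_pow_of_memLp
        (memLp_linearComb (b := b) hid hK (insert i F)) (by omega))
        (i01.add i23) fun ω => ?_
      have := hTaylor (S ω) (b i * ξ i ω)
      simp only [Finset.sum_insert hiF]
      rw [add_comm (b i * ξ i ω)]
      refine this.trans (le_of_eq ?_)
      rw [abs_mul]
      ring
    have hSm' := hbound F b R hR hF'
    have hpow : |b i| ^ (m + 2) ≤ R ^ m * b i ^ 2 := by
      rw [pow_add, sq_abs]
      gcongr
      exact abs_le_of_sq_le_sq hbi hR
    refine hle.trans ?_
    rw [integral_add i01 i23, integral_add a0 i1, integral_const_mul, integral_const_mul,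
      integral_add i2 i3, integral_const_mul, integral_const_mul, e1, e2, e3]
    have ih' := ih hF'
    have k1 : b i ^ 2 * ((∫ ω, |S ω| ^ m ∂P) * v) ≤ b i ^ 2 * (D * R ^ m * v) := by gcongr
    have k2 : |b i| ^ (m + 2) * w ≤ R ^ m * b i ^ 2 * w := by gcongr
    have k3 := mul_le_mul_of_nonneg_left (add_le_add k1 k2) hC
    nlinarith [k3, ih']

/-- A weak form of Rosenthal's inequality: the absolute moment of order `k` of a linear
combination of i.i.d. centred variables is bounded by a multiple of the `k`-th power of the
`ℓ²`-norm of its coefficients. -/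
theorem exists_moment_bound (hm : ∀ i, Measurable (ξ i)) (hi : iIndepFun ξ P)
    (hid : ∀ i, IdentDistrib (ξ i) ζ P P) {K : ℕ} (hK : MemLp ζ (K : ℝ≥0∞) P) (hK2 : 2 ≤ K)
    (h0 : ∫ ω, ζ ω ∂P = 0) (k : ℕ) (hk : k ≤ K) :
    ∃ D : ℝ, 0 ≤ D ∧ ∀ (F : Finset ι) (b : ι → ℝ) (R : ℝ), 0 ≤ R →
      ∑ i ∈ F, b i ^ 2 ≤ R ^ 2 → ∫ ω, |∑ i ∈ F, b i * ξ i ω| ^ k ∂P ≤ D * R ^ k := by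
  have base : ∀ (F : Finset ι) (b : ι → ℝ) (R : ℝ), 0 ≤ R → ∑ i ∈ F, b i ^ 2 ≤ R ^ 2 →
      ∫ ω, |∑ i ∈ F, b i * ξ i ω| ^ 0 ∂P ≤ 1 * R ^ 0 := by
    intro F b R _ _
    simp
  induction k using Nat.twoStepInduction with
  | zero => exact ⟨1, zero_le_one, base⟩
  | one =>
    obtain ⟨D, hD, h2⟩ := exists_moment_bound_step hm hi hid hK h0 (m := 0) hK2 zero_le_one base
    refine ⟨√D, Real.sqrt_nonneg D, fun F b R hR hF => ?_⟩
    have hS : MemLp (fun ω => |∑ i ∈ F, b i * ξ i ω|) 2 P :=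
      ((memLp_linearComb (b := b) hid hK F).mono_exponent (by exact_mod_cast hK2)).abs
    have hvar := variance_nonneg (fun ω => |∑ i ∈ F, b i * ξ i ω|) P
    rw [variance_eq_sub hS] at hvar
    have h3 := h2 F b R hR hF
    simp only [pow_one, Pi.pow_apply] at hvar ⊢
    refine (abs_le_of_sq_le_sq' ?_ (by positivity)).2
    rw [mul_pow, Real.sq_sqrt hD]
    simp only [zero_add] at h3
    linarith
  | more k ih _ =>
    obtain ⟨D, hD, h⟩ := ih (by omega)
    exact exists_moment_bound_step hm hi hid hK h0 hk hD h

end Rosenthal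

/-! ### Convergence of moments under `L^K`-convergence -/

theorem exists_abs_add_pow_sub_pow_le (r : ℕ) {δ : ℝ} (hδ : 0 < δ) : ∃ C : ℝ, 0 ≤ C ∧
    ∀ x h : ℝ, |(x + h) ^ r - x ^ r| ≤ δ * |x| ^ r + C * |h| ^ r := by
  cases r with
  | zero => exact ⟨0, le_rfl, fun x h => by simp [hδ.le]⟩
  | succ s =>
    -- `τ` separates the cases `|h| ≤ τ |x|` and `|x| < |h| / τ`
    set τ : ℝ := min 1 (δ / ((s + 1) * 2 ^ s)) with hτ
    have hτ0 : 0 < τ := lt_min one_pos (by positivity)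
    have hτ1 : τ ≤ 1 := min_le_left _ _
    have hτ2 : τ * ((s + 1) * 2 ^ s) ≤ δ := by
      rw [← le_div_iff₀ (by positivity)]
      exact min_le_right _ _
    refine ⟨(s + 1) * (1 + 1 / τ) ^ s, by positivity, fun x h => ?_⟩
    have hb := abs_pow_sub_pow_le (x + h) x (s + 1)
    simp only [add_sub_cancel_left, Nat.add_sub_cancel] at hb
    refine hb.trans ?_
    push_cast
    rcases le_or_gt |h| (τ * |x|) with hx | hx
    · have hh : |h| ≤ |x| := hx.trans (by nlinarith [abs_nonneg x])
      have hm : max |x + h| |x| ≤ 2 * |x| :=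
        max_le ((abs_add_le x h).trans (by linarith)) (by linarith [abs_nonneg x])
      calc |h| * (s + 1) * max |x + h| |x| ^ s ≤ τ * |x| * (s + 1) * (2 * |x|) ^ s := by gcongr
        _ = τ * ((s + 1) * 2 ^ s) * |x| ^ (s + 1) := by ring
        _ ≤ δ * |x| ^ (s + 1) := by gcongr
        _ ≤ _ := le_add_of_nonneg_right (by positivity)
    · have hx' : |x| ≤ 1 / τ * |h| := by
        rw [one_div, ← div_eq_inv_mul, le_div_iff₀ hτ0, mul_comm]
        exact hx.le
      have hm : max |x + h| |x| ≤ (1 + 1 / τ) * |h| :=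
        max_le ((abs_add_le x h).trans (by linarith)) (by linarith [abs_nonneg h])
      calc |h| * (s + 1) * max |x + h| |x| ^ s ≤ |h| * (s + 1) * ((1 + 1 / τ) * |h|) ^ s := by
            gcongr
        _ = (s + 1) * (1 + 1 / τ) ^ s * |h| ^ (s + 1) := by rw [mul_pow]; ring
        _ ≤ _ := le_add_of_nonneg_left (by positivity)

section Convergence

variable {Ω : Type*} [MeasurableSpace Ω] {P : Measure Ω} [IsProbabilityMeasure P]

theorem ofReal_integral_abs_pow {g : Ω → ℝ} {r : ℕ} (hr : r ≠ 0) (hg : MemLp g (r : ℝ≥0∞) P) :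
    ENNReal.ofReal (∫ ω, |g ω| ^ r ∂P) = eLpNorm g (r : ℝ≥0∞) P ^ r := by
  have h := eLpNorm_nnreal_pow_eq_lintegral (f := g) (μ := P) (p := (r : NNReal))
    (by exact_mod_cast hr)
  simp only [NNReal.coe_natCast, ENNReal.rpow_natCast, ENNReal.coe_natCast] at h
  rw [h, ofReal_integral_eq_lintegral_ofReal (integrable_abs_pow_of_memLp hg le_rfl)
    (ae_of_all _ fun ω => by positivity)]
  refine lintegral_congr fun ω => ?_
  rw [ENNReal.ofReal_pow (abs_nonneg _), ← Real.norm_eq_abs, ofReal_norm]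

theorem tendsto_integral_pow_of_tendsto_eLpNorm {f : Ω → ℝ} {g : ℕ → Ω → ℝ} {K : ℕ}
    (hf : MemLp f (K : ℝ≥0∞) P) (hg : ∀ N, MemLp (g N) (K : ℝ≥0∞) P)
    (h : Tendsto (fun N => eLpNorm (f - g N) (K : ℝ≥0∞) P) atTop (𝓝 0)) {r : ℕ} (hr : r ≤ K) :
    Tendsto (fun N => ∫ ω, g N ω ^ r ∂P) atTop (𝓝 (∫ ω, f ω ^ r ∂P)) := by
  rcases eq_or_ne r 0 with rfl | hr0
  · simp
  have hsub : ∀ N, MemLp (f - g N) (r : ℝ≥0∞) P := fun N =>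
    (hf.sub (hg N)).mono_exponent (by exact_mod_cast hr)
  have hr' : Tendsto (fun N => eLpNorm (f - g N) (r : ℝ≥0∞) P) atTop (𝓝 0) :=
    tendsto_of_tendsto_of_tendsto_of_le_of_le tendsto_const_nhds h (fun _ => zero_le)
      fun N => eLpNorm_le_eLpNorm_of_exponent_le (by exact_mod_cast hr) (hsub N).1
  have hint : Tendsto (fun N => ∫ ω, |(f - g N) ω| ^ r ∂P) atTop (𝓝 0) := by
    have h1 : Tendsto (fun N => eLpNorm (f - g N) (r : ℝ≥0∞) P ^ r) atTop (𝓝 0) := by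
      simpa [hr0] using ENNReal.Tendsto.pow (n := r) hr'
    simp_rw [← ofReal_integral_abs_pow hr0 (hsub _)] at h1
    have h2 := (ENNReal.tendsto_toReal ENNReal.zero_ne_top).comp h1
    refine h2.congr fun N => ?_
    exact ENNReal.toReal_ofReal (integral_nonneg fun ω => by positivity)
  set A := ∫ ω, |f ω| ^ r ∂P
  have hA : 0 ≤ A := integral_nonneg fun ω => by positivity
  rw [Metric.tendsto_atTop]
  intro η hη
  obtain ⟨C, hC, hbd⟩ := exists_abs_add_pow_sub_pow_le r (δ := η / (2 * (A + 1))) (by positivity)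
  have hlim : Tendsto (fun N => C * ∫ ω, |(f - g N) ω| ^ r ∂P) atTop (𝓝 0) := by
    simpa using hint.const_mul C
  obtain ⟨N₀, hN₀⟩ := (Metric.tendsto_atTop.mp hlim) (η / 2) (by positivity)
  refine ⟨N₀, fun N hN => ?_⟩
  have h1 := (abs_lt.mp (by simpa only [Real.dist_eq, sub_zero] using hN₀ N hN)).2
  have if1 := integrable_pow_of_memLp hf hr
  have ig1 := integrable_pow_of_memLp (hg N) hr
  have iA := (integrable_abs_pow_of_memLp hf hr).const_mul (η / (2 * (A + 1)))
  have iB := (integrable_abs_pow_of_memLp (hsub N) le_rfl).const_mul C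
  rw [Real.dist_eq, ← integral_sub ig1 if1]
  have h2 : |∫ ω, (g N ω ^ r - f ω ^ r) ∂P| ≤
      ∫ ω, (η / (2 * (A + 1)) * |f ω| ^ r + C * |(f - g N) ω| ^ r) ∂P := by
    refine (abs_integral_le_integral_abs).trans (integral_mono (ig1.sub if1).abs (iA.add iB)
      fun ω => ?_)
    have := hbd (f ω) (g N ω - f ω)
    rw [add_sub_cancel, abs_sub_comm (g N ω)] at this
    exact this
  rw [integral_add iA iB, integral_const_mul, integral_const_mul] at h2
  have h3 : η / (2 * (A + 1)) * A ≤ η / 2 := by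
    rw [div_mul_eq_mul_div, div_le_div_iff₀ (by positivity) (by positivity)]
    nlinarith
  change |∫ ω, (g N ω ^ r - f ω ^ r) ∂P| < η
  linarith

/-- A series of i.i.d. centred variables with square-summable coefficients that converges in mean
square converges in every `L^K` to which the summands belong. -/
theorem tendsto_eLpNorm_linearSeries {ξ : ℕ → Ω → ℝ} {ζ : Ω → ℝ} (hm : ∀ i, Measurable (ξ i))
    (hi : iIndepFun ξ P) (hid : ∀ i, IdentDistrib (ξ i) ζ P P) {K : ℕ}
    (hK : MemLp ζ (K : ℝ≥0∞) P) (hK2 : 2 ≤ K) (h0 : ∫ ω, ζ ω ∂P = 0) {a : ℕ → ℝ}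
    (ha : Summable fun i => a i ^ 2) {Y : Ω → ℝ} (hY : AEStronglyMeasurable Y P)
    (hlim : Tendsto (fun N : ℕ => eLpNorm (fun ω => Y ω - ∑ i ∈ Finset.range N, a i * ξ i ω) 2 P)
      atTop (𝓝 0)) :
    Tendsto (fun N : ℕ => eLpNorm (fun ω => Y ω - ∑ i ∈ Finset.range N, a i * ξ i ω) K P)
      atTop (𝓝 0) := by
  set T : ℕ → Ω → ℝ := fun N ω => ∑ i ∈ Finset.range N, a i * ξ i ω with hT
  have hTm : ∀ N, AEStronglyMeasurable (T N) P := fun N =>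
    (Finset.measurable_sum _ fun i _ => (hm i).const_mul _).aestronglyMeasurable
  have hK0 : K ≠ 0 := by omega
  -- almost sure convergence along a subsequence
  have hmeas : TendstoInMeasure P T atTop Y := by
    refine tendstoInMeasure_of_tendsto_eLpNorm (p := 2) two_ne_zero hTm hY ?_
    refine hlim.congr fun N => ?_
    exact eLpNorm_sub_comm Y (T N) 2 P
  obtain ⟨ns, hns, hae⟩ := hmeas.exists_seq_tendsto_ae
  obtain ⟨D, hD, hbound⟩ := exists_moment_bound hm hi hid hK hK2 h0 K le_rfl
  set D' := max D 1 with hD'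
  have hD'1 : 1 ≤ D' := le_max_right _ _
  have hDD : D ≤ D' ^ K := (le_max_left _ _).trans (le_self_pow₀ hD'1 hK0)
  -- `R M` is the `ℓ²`-norm of the tail of `a`
  set R : ℕ → ℝ := fun M => √(∑' i, a (i + M) ^ 2) with hR
  have hR0 : Tendsto R atTop (𝓝 0) := by
    have := (tendsto_sum_nat_add fun i => a i ^ 2).sqrt
    simpa using this
  have hblock : ∀ M N, M ≤ N → eLpNorm (T N - T M) K P ≤ ENNReal.ofReal (D' * R M) := by
    intro M N hMN
    have hdiff : T N - T M = fun ω => ∑ i ∈ Finset.Ico M N, a i * ξ i ω := by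
      ext ω
      simp only [hT, Pi.sub_apply]
      rw [Finset.sum_Ico_eq_sub _ hMN]
    have hL := memLp_linearComb (b := a) hid hK (Finset.Ico M N)
    have hs : ∑ i ∈ Finset.Ico M N, a i ^ 2 ≤ R M ^ 2 := by
      rw [hR, Real.sq_sqrt (tsum_nonneg fun i => sq_nonneg _), Finset.sum_Ico_eq_sum_range]
      simp_rw [add_comm M]
      exact ((summable_nat_add_iff M).mpr ha).sum_le_tsum _ fun i _ => sq_nonneg _
    have h1 := hbound (Finset.Ico M N) a (R M) (Real.sqrt_nonneg _) hs
    rw [hdiff]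
    refine (ENNReal.pow_le_pow_left_iff hK0).mp ?_
    rw [← ofReal_integral_abs_pow hK0 hL, ← ENNReal.ofReal_pow (by positivity)]
    refine ENNReal.ofReal_le_ofReal (h1.trans ?_)
    rw [mul_pow]
    gcongr
  have hfin : ∀ M, eLpNorm (Y - T M) K P ≤ ENNReal.ofReal (D' * R M) := by
    intro M
    refine (Lp.eLpNorm_lim_le_liminf_eLpNorm (f := fun j => T (ns j) - T M)
      (fun j => (hTm _).sub (hTm _)) (Y - T M) ?_).trans ?_
    · filter_upwards [hae] with ω hω
      exact hω.sub_const _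
    · refine (liminf_le_liminf (v := fun _ => ENNReal.ofReal (D' * R M)) ?_).trans
        (liminf_const _).le
      filter_upwards [eventually_ge_atTop M] with j hj
      exact hblock M (ns j) (hj.trans (hns.id_le j))
  refine tendsto_of_tendsto_of_tendsto_of_le_of_le tendsto_const_nhds ?_ (fun _ => zero_le) hfin
  have := ENNReal.tendsto_ofReal (hR0.const_mul D')
  simpa using this

end Convergence

/-! ### Partial sums of the linear process in terms of the noise -/

/-- The coefficient of `ε (n - N)` in the partial sum `S_n`: the sum of `a N, a (N - 1), …` over a
window of length `n`, with the convention that `a` vanishes at negative indices. -/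
def windowSum (a : ℕ → ℝ) (n N : ℕ) : ℝ :=
  ∑ s ∈ Finset.range n, if s ≤ N then a (N - s) else 0

/-- The sequence `a` cut off at `M`. -/
def truncSeq (a : ℕ → ℝ) (M i : ℕ) : ℝ := if i < M then a i else 0

theorem sum_truncated_eq_windowSum (a : ℕ → ℝ) (e : ℤ → ℝ) (n M : ℕ) :
    ∑ t ∈ Finset.Icc 1 n, ∑ i ∈ Finset.range M, a i * e ((t : ℤ) - (i : ℤ))
      = ∑ N ∈ Finset.range (n + M), windowSum (truncSeq a M) n N * e ((n : ℤ) - (N : ℤ)) := by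
  have h1 : ∑ t ∈ Finset.Icc 1 n, ∑ i ∈ Finset.range M, a i * e ((t : ℤ) - (i : ℤ))
      = ∑ s ∈ Finset.range n, ∑ i ∈ Finset.range M, a i * e ((n : ℤ) - ((s + i : ℕ) : ℤ)) := by
    refine Finset.sum_nbij' (fun t => n - t) (fun s => n - s) ?_ ?_ ?_ ?_ ?_
    · intro t ht; simp only [Finset.mem_Icc, Finset.mem_range] at ht ⊢; omega
    · intro s hs; simp only [Finset.mem_Icc, Finset.mem_range] at hs ⊢; omega
    · intro t ht; simp only [Finset.mem_Icc] at ht; omega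
    · intro s hs; simp only [Finset.mem_range] at hs; omega
    · intro t ht
      simp only [Finset.mem_Icc] at ht
      refine Finset.sum_congr rfl fun i _ => ?_
      congr 2
      push_cast [Nat.cast_sub ht.2]
      ring
  rw [h1]
  simp only [windowSum, Finset.sum_mul]
  rw [Finset.sum_comm (s := Finset.range (n + M))]
  refine Finset.sum_congr rfl fun s hs => ?_
  rw [Finset.mem_range] at hs
  have h2 : ∑ N ∈ Finset.Ico s (s + M),
      (if s ≤ N then truncSeq a M (N - s) else 0) * e ((n : ℤ) - (N : ℤ))
      = ∑ i ∈ Finset.range M, a i * e ((n : ℤ) - ((s + i : ℕ) : ℤ)) := by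
    rw [Finset.sum_Ico_eq_sum_range]
    simp only [Nat.add_sub_cancel_left]
    refine Finset.sum_congr rfl fun i hi => ?_
    rw [Finset.mem_range] at hi
    simp [truncSeq, hi]
  rw [← h2]
  refine Finset.sum_subset (fun N hN => ?_) fun N _ hN => ?_
  · simp only [Finset.mem_Ico, Finset.mem_range] at hN ⊢; omega
  · rw [Finset.mem_Ico, not_and_or, not_le, not_lt] at hN
    rcases hN with hN | hN
    · rw [if_neg (by omega), zero_mul]
    · rw [if_pos (by omega), truncSeq, if_neg (by omega), zero_mul]

theorem windowSum_truncSeq_of_le (a : ℕ → ℝ) {n M N : ℕ} (hN : n + M ≤ N) :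
    windowSum (truncSeq a M) n N = 0 := by
  refine Finset.sum_eq_zero fun s hs => ?_
  rw [Finset.mem_range] at hs
  rw [if_pos (by omega), truncSeq, if_neg (by omega)]

theorem windowSum_truncSeq_of_lt (a : ℕ → ℝ) (n : ℕ) {M N : ℕ} (hN : N < M) :
    windowSum (truncSeq a M) n N = windowSum a n N := by
  refine Finset.sum_congr rfl fun s _ => ?_
  simp only [truncSeq, if_pos (show N - s < M by omega)]

theorem abs_windowSum_le_of_abs_le {a b : ℕ → ℝ} (h : ∀ i, |a i| ≤ b i) (n N : ℕ) :
    |windowSum a n N| ≤ windowSum b n N := by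
  refine (Finset.abs_sum_le_sum_abs _ _).trans (Finset.sum_le_sum fun s _ => ?_)
  split_ifs
  · exact h _
  · simp

theorem summable_windowSum_sq {a : ℕ → ℝ} (ha : Summable fun i => a i ^ 2) (n : ℕ) :
    Summable fun N => windowSum a n N ^ 2 := by
  have h1 : ∀ s : ℕ, Summable fun N => (if s ≤ N then a (N - s) else 0) ^ 2 := by
    intro s
    rw [← summable_nat_add_iff s]
    simpa using ha
  refine Summable.of_nonneg_of_le (fun N => sq_nonneg _) (fun N => ?_)
    ((summable_sum fun s (_ : s ∈ Finset.range n) => h1 s).mul_left (n : ℝ))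
  have := sq_sum_le_card_mul_sum_sq (s := Finset.range n)
    (f := fun s => if s ≤ N then a (N - s) else 0)
  simpa [windowSum] using this

theorem summable_pow_of_summable_sq {u : ℕ → ℝ} (hu : Summable fun i => u i ^ 2) {r : ℕ}
    (hr : 2 ≤ r) : Summable fun i => |u i| ^ r := by
  refine Summable.of_norm_bounded_eventually_nat hu ?_
  filter_upwards [hu.tendsto_atTop_zero.eventually (gt_mem_nhds one_pos)] with i hi
  have h1 : |u i| ≤ 1 := abs_le_one_iff_mul_self_le_one.mpr (by nlinarith)
  rw [Real.norm_of_nonneg (by positivity), ← sq_abs (u i)]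
  exact pow_le_pow_of_le_one (abs_nonneg _) h1 hr

theorem summable_abs_windowSum_pow {a : ℕ → ℝ} (ha : Summable fun i => a i ^ 2) (n : ℕ) {r : ℕ}
    (hr : 2 ≤ r) : Summable fun N => |windowSum a n N| ^ r :=
  summable_pow_of_summable_sq (summable_windowSum_sq ha n) hr

theorem tendsto_powerSum_truncSeq {a : ℕ → ℝ} (ha : Summable fun i => a i ^ 2) (n : ℕ) {r : ℕ}
    (hr : 2 ≤ r) :
    Tendsto (fun M => ∑ N ∈ Finset.range (n + M), windowSum (truncSeq a M) n N ^ r) atTop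
      (𝓝 (∑' N, windowSum a n N ^ r)) := by
  have h1 : ∀ M, ∑ N ∈ Finset.range (n + M), windowSum (truncSeq a M) n N ^ r
      = ∑' N, windowSum (truncSeq a M) n N ^ r := by
    intro M
    refine (tsum_eq_sum fun N hN => ?_).symm
    rw [Finset.mem_range, not_lt] at hN
    rw [windowSum_truncSeq_of_le a hN, zero_pow (by omega)]
  simp_rw [h1]
  refine tendsto_tsum_of_dominated_convergence
    (bound := fun N => |windowSum (fun i => |a i|) n N| ^ r)
    (summable_abs_windowSum_pow (by simpa using ha) n hr) (fun N => ?_)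
    (Eventually.of_forall fun M N => ?_)
  · refine tendsto_const_nhds.congr' ?_
    filter_upwards [eventually_gt_atTop N] with M hM
    rw [windowSum_truncSeq_of_lt a n hM]
  · rw [norm_pow, Real.norm_eq_abs]
    refine pow_le_pow_left₀ (abs_nonneg _) ((abs_windowSum_le_of_abs_le (fun i => ?_) n N).trans
      (le_abs_self _)) r
    rw [truncSeq]
    split_ifs <;> simp

section PartialSums

variable {Ω : Type*} [MeasurableSpace Ω] {P : Measure Ω} [IsProbabilityMeasure P]
  {a : ℕ → ℝ} {ε : ℤ → Ω → ℝ} {X : ℕ → Ω → ℝ} {σ : ℝ}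

theorem tendsto_eLpNorm_partialSum (hε : IsIIDWhiteNoise P ε σ) (hX : IsLinearProcess P a ε X)
    {K : ℕ} (hK : MemLp (ε 1) (K : ℝ≥0∞) P) (hK2 : 2 ≤ K) (n : ℕ) :
    MemLp (partialSum X n) (K : ℝ≥0∞) P ∧
    Tendsto (fun M : ℕ => eLpNorm (partialSum X n - fun ω => ∑ N ∈ Finset.range (n + M),
      windowSum (truncSeq a M) n N * ε ((n : ℤ) - (N : ℤ)) ω) K P) atTop (𝓝 0) := by
  have hpart : ∀ (M t : ℕ), MemLp (fun ω => ∑ i ∈ Finset.range M, a i * ε ((t : ℤ) - (i : ℤ)) ω)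
      (K : ℝ≥0∞) P := fun M t =>
    memLp_linearComb (ξ := fun i : ℕ => ε ((t : ℤ) - (i : ℤ)))
      (fun i => hε.identDistrib _) hK _ _
  have hXt : ∀ t, 1 ≤ t → Tendsto (fun M : ℕ => eLpNorm
      (fun ω => X t ω - ∑ i ∈ Finset.range M, a i * ε ((t : ℤ) - (i : ℤ)) ω) K P) atTop (𝓝 0) := by
    intro t ht
    exact tendsto_eLpNorm_linearSeries (ξ := fun i : ℕ => ε ((t : ℤ) - (i : ℤ)))
      (fun i => hε.measurable _) (hε.indep.precomp fun i j h => by simpa using h)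
      (fun i => hε.identDistrib _) hK hK2 hε.mean_zero hX.summable_sq (hX.memLp_two t ht).1
      (hX.tendsto_partial t ht)
  have hXmem : ∀ t, 1 ≤ t → MemLp (X t) (K : ℝ≥0∞) P := by
    intro t ht
    obtain ⟨M, hM⟩ := ((hXt t ht).eventually (gt_mem_nhds ENNReal.zero_lt_top)).exists
    have h1 : MemLp (fun ω => X t ω - ∑ i ∈ Finset.range M, a i * ε ((t : ℤ) - (i : ℤ)) ω)
        (K : ℝ≥0∞) P := ⟨(hX.memLp_two t ht).1.sub (hpart M t).1, hM⟩
    refine (h1.add (hpart M t)).congr_norm (hX.memLp_two t ht).1 (ae_of_all _ fun ω => ?_)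
    simp
  refine ⟨memLp_finsetSum _ fun t ht => hXmem t (Finset.mem_Icc.mp ht).1, ?_⟩
  have hsum : Tendsto (fun M : ℕ => ∑ t ∈ Finset.Icc 1 n, eLpNorm
      (fun ω => X t ω - ∑ i ∈ Finset.range M, a i * ε ((t : ℤ) - (i : ℤ)) ω) K P) atTop (𝓝 0) := by
    have := tendsto_finsetSum (Finset.Icc 1 n) fun t ht => hXt t (Finset.mem_Icc.mp ht).1
    simpa using this
  refine tendsto_of_tendsto_of_tendsto_of_le_of_le tendsto_const_nhds hsum (fun _ => zero_le)
    fun M => ?_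
  refine le_trans (le_of_eq ?_) (eLpNorm_sum_le (fun t ht =>
    ((hXmem t (Finset.mem_Icc.mp ht).1).sub (hpart M t)).1) (by exact_mod_cast (by omega : 1 ≤ K)))
  congr 1
  ext ω
  simp only [Pi.sub_apply, partialSum, Finset.sum_apply, Finset.sum_sub_distrib]
  rw [sum_truncated_eq_windowSum a (fun i => ε i ω) n M]

/-- The moments of `S_n` satisfy the cumulant recursion, the cumulant of order `r + 1` being that
of the noise times the power sum of order `r + 1` of the coefficients. For `r = 0` that power sum
may diverge, but it is multiplied by the vanishing first cumulant of the noise. -/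
theorem partialSum_moment_recursion (hε : IsIIDWhiteNoise P ε σ) (hX : IsLinearProcess P a ε X)
    {K : ℕ} (hK : MemLp (ε 1) (K : ℝ≥0∞) P) (hK2 : 2 ≤ K) (n : ℕ) {j : ℕ} (hj : j + 1 ≤ K) :
    ((j : ℝ) + 1) * ((∫ ω, partialSum X n ω ^ (j + 1) ∂P) / ((j + 1).factorial : ℝ)) =
      ∑ r ∈ Finset.range (j + 1), (logDerivCoeff (fun s => ∫ ω, ε 1 ω ^ s ∂P) r
        * ∑' N, windowSum a n N ^ (r + 1))
        * ((∫ ω, partialSum X n ω ^ (j - r) ∂P) / ((j - r).factorial : ℝ)) := by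
  obtain ⟨hS, hconv⟩ := tendsto_eLpNorm_partialSum hε hX hK hK2 n
  have hmem : ∀ M, MemLp (fun ω => ∑ N ∈ Finset.range (n + M),
      windowSum (truncSeq a M) n N * ε ((n : ℤ) - (N : ℤ)) ω) (K : ℝ≥0∞) P := fun M =>
    memLp_linearComb (ξ := fun N : ℕ => ε ((n : ℤ) - (N : ℤ)))
      (fun i => hε.identDistrib _) hK _ _
  have hmom := fun r (hr : r ≤ K) => tendsto_integral_pow_of_tendsto_eLpNorm hS hmem hconv hr
  have hrec := fun M => moment_linearComb_recursion (ξ := fun N : ℕ => ε ((n : ℤ) - (N : ℤ)))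
    (fun i => hε.measurable _) (hε.indep.precomp fun i j h => by simpa using h)
    (fun i => hε.identDistrib _) hK (Finset.range (n + M)) (windowSum (truncSeq a M) n) hj
  refine tendsto_nhds_unique (((hmom (j + 1) hj).div_const _).const_mul ((j : ℝ) + 1)) ?_
  simp_rw [hrec]
  refine tendsto_finsetSum _ fun r _ => Tendsto.mul ?_ ((hmom (j - r) (by omega)).div_const _)
  rcases Nat.eq_zero_or_pos r with rfl | hr
  · have : logDerivCoeff (fun s => ∫ ω, ε 1 ω ^ s ∂P) 0 = 0 := by
      rw [logDerivCoeff_zero _ (by simp)]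
      simpa using hε.mean_zero
    simp [this]
  · exact (tendsto_powerSum_truncSeq hX.summable_sq n (by omega)).const_mul _

end PartialSums

/-! ### Limits of sequences solving the cumulant recursion -/

/-- Suppose that `e n` solves the moment-cumulant recursion with cumulants `ℓ r * q n (r + 1)`
(up to factorials), of which the first vanishes, the second converges and those of higher order
tend to zero. Then `e n` converges to the solution of the recursion of a normal law: only the
second cumulant survives. -/
theorem tendsto_of_recursion {e q : ℕ → ℕ → ℝ} {ℓ : ℕ → ℝ} {K : ℕ} {A : ℝ} (hℓ : ℓ 0 = 0)
    (he0 : ∀ n, e n 0 = 1)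
    (hrec : ∀ j, j + 1 ≤ K → ∀ᶠ n in atTop, ((j : ℝ) + 1) * e n (j + 1) =
      ∑ r ∈ Finset.range (j + 1), (ℓ r * q n (r + 1)) * e n (j - r))
    (hq2 : Tendsto (fun n => q n 2) atTop (𝓝 A))
    (hq : ∀ r, 3 ≤ r → Tendsto (fun n => q n r) atTop (𝓝 0)) (k : ℕ) (hk : k ≤ K) :
    Tendsto (fun n => e n k) atTop
      (𝓝 (if Even k then (ℓ 1 * A / 2) ^ (k / 2) / ((k / 2).factorial : ℝ) else 0)) := by
  induction k using Nat.strong_induction_on with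
  | _ k ih =>
    match k, ih, hk with
    | 0, _, _ => simp [he0]
    | 1, _, hk =>
      simp only [Nat.not_even_one, if_false]
      refine tendsto_const_nhds.congr' ?_
      filter_upwards [hrec 0 hk] with n hn
      simpa [hℓ] using hn.symm
    | i + 2, ih, hk =>
      have hlim : Tendsto (fun n => ((∑ r ∈ Finset.range i, (ℓ (r + 2) * q n (r + 3)) *
          e n (i - 1 - r)) + (ℓ 1 * q n 2) * e n i) / ((i : ℝ) + 2)) atTop
          (𝓝 ((∑ r ∈ Finset.range i, (ℓ (r + 2) * 0) *
            (if Even (i - 1 - r) then (ℓ 1 * A / 2) ^ ((i - 1 - r) / 2)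
              / (((i - 1 - r) / 2).factorial : ℝ) else 0)
            + (ℓ 1 * A) * (if Even i then (ℓ 1 * A / 2) ^ (i / 2)
              / ((i / 2).factorial : ℝ) else 0)) / ((i : ℝ) + 2))) := by
        refine Tendsto.div_const (Tendsto.add (tendsto_finsetSum _ fun r hr => ?_) ?_) _
        · exact ((hq (r + 3) (by omega)).const_mul _).mul (ih _ (by omega) (by omega))
        · exact (hq2.const_mul _).mul (ih _ (by omega) (by omega))
      have hval : (if Even (i + 2) then (ℓ 1 * A / 2) ^ ((i + 2) / 2)
          / (((i + 2) / 2).factorial : ℝ) else 0) =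
          (∑ r ∈ Finset.range i, (ℓ (r + 2) * 0) *
            (if Even (i - 1 - r) then (ℓ 1 * A / 2) ^ ((i - 1 - r) / 2)
              / (((i - 1 - r) / 2).factorial : ℝ) else 0)
            + (ℓ 1 * A) * (if Even i then (ℓ 1 * A / 2) ^ (i / 2)
              / ((i / 2).factorial : ℝ) else 0)) / ((i : ℝ) + 2) := by
        simp only [mul_zero, zero_mul, Finset.sum_const_zero, zero_add]
        by_cases hi : Even i
        · have hi2 : Even (i + 2) := by simpa [Nat.even_add] using hi
          rw [if_pos hi, if_pos hi2]
          obtain ⟨p, rfl⟩ := hi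
          rw [show (p + p + 2) / 2 = p + 1 by omega, show (p + p) / 2 = p by omega,
            Nat.factorial_succ]
          have : (p.factorial : ℝ) ≠ 0 := by positivity
          push_cast
          field_simp
          ring
        · have hi2 : ¬ Even (i + 2) := by simpa [Nat.even_add] using hi
          rw [if_neg hi, if_neg hi2]
          simp
      rw [hval]
      refine hlim.congr' ?_
      filter_upwards [hrec (i + 1) (by omega)] with n hn
      rw [Finset.sum_range_succ', Finset.sum_range_succ'] at hn
      simp only [hℓ, zero_mul, add_zero, zero_add, Nat.add_sub_cancel] at hn
      rw [div_eq_iff (by positivity)]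
      push_cast at hn
      rw [show e n (i + 2) * ((i : ℝ) + 2) = ((i : ℝ) + 1 + 1) * e n (i + 1 + 1) by ring, hn]
      congr 1
      refine Finset.sum_congr rfl fun r _ => ?_
      rw [show i - (r + 1) = i - 1 - r by omega]

/-- Odd orders in the setting of `tendsto_of_recursion`: after multiplication by a weight `w`
that balances the third cumulant and is negligible against those of order at least four, the
limit is linear in the third cumulant. -/
theorem tendsto_mul_odd_of_recursion {e q : ℕ → ℕ → ℝ} {w ℓ : ℕ → ℝ} {K : ℕ} {A B : ℝ}
    (hℓ : ℓ 0 = 0) (he0 : ∀ n, e n 0 = 1)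
    (hrec : ∀ j, j + 1 ≤ K → ∀ᶠ n in atTop, ((j : ℝ) + 1) * e n (j + 1) =
      ∑ r ∈ Finset.range (j + 1), (ℓ r * q n (r + 1)) * e n (j - r))
    (hq2 : Tendsto (fun n => q n 2) atTop (𝓝 A))
    (hq : ∀ r, 3 ≤ r → Tendsto (fun n => q n r) atTop (𝓝 0))
    (hw3 : Tendsto (fun n => w n * q n 3) atTop (𝓝 B))
    (hw : ∀ r, 4 ≤ r → Tendsto (fun n => w n * q n r) atTop (𝓝 0))
    (l : ℕ) (hl : 3 + 2 * l ≤ K) :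
    Tendsto (fun n => w n * e n (3 + 2 * l)) atTop
      (𝓝 (ℓ 2 * B / 3 * ((ℓ 1 * A / 2) ^ l / (l.factorial : ℝ)))) := by
  have heven := tendsto_of_recursion hℓ he0 hrec hq2 hq
  -- the recursion for `e n (3 + 2 * l)`, with the three lowest cumulants separated
  have hsplit : ∀ l, 3 + 2 * l ≤ K → ∀ᶠ n in atTop, w n * e n (3 + 2 * l) =
      ((∑ r ∈ Finset.range (2 * l), (ℓ (r + 3) * (w n * q n (r + 4))) * e n (2 * l - 1 - r))
        + (ℓ 2 * (w n * q n 3)) * e n (2 * l) + (ℓ 1 * q n 2) * (w n * e n (1 + 2 * l)))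
        / (3 + 2 * (l : ℝ)) := by
    intro l hl
    filter_upwards [hrec (2 * l + 2) (by omega)] with n hn
    rw [Finset.sum_range_succ', Finset.sum_range_succ', Finset.sum_range_succ'] at hn
    simp only [hℓ, zero_mul, add_zero, zero_add] at hn
    rw [eq_div_iff (by positivity)]
    push_cast at hn
    simp only [show 2 * l + 1 = 1 + 2 * l by ring] at hn
    have h1 : ∑ r ∈ Finset.range (2 * l), (ℓ (r + 3) * (w n * q n (r + 4)))
        * e n (2 * l - 1 - r) = w n * ∑ r ∈ Finset.range (2 * l),
          ℓ (r + 1 + 1 + 1) * q n (r + 1 + 1 + 1 + 1) * e n (2 * l - (r + 1)) := by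
      rw [Finset.mul_sum]
      refine Finset.sum_congr rfl fun r _ => ?_
      rw [show 2 * l - (r + 1) = 2 * l - 1 - r by omega]
      ring
    rw [h1]
    rw [show 3 + 2 * l = 2 * l + 2 + 1 by ring]
    linear_combination w n * hn
  have hrest : ∀ l, 3 + 2 * l ≤ K → Tendsto (fun n => (∑ r ∈ Finset.range (2 * l),
      (ℓ (r + 3) * (w n * q n (r + 4))) * e n (2 * l - 1 - r))
        + (ℓ 2 * (w n * q n 3)) * e n (2 * l)) atTop
      (𝓝 (ℓ 2 * B * ((ℓ 1 * A / 2) ^ l / (l.factorial : ℝ)))) := by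
    intro l hl
    have h1 : Tendsto (fun n => ∑ r ∈ Finset.range (2 * l),
        (ℓ (r + 3) * (w n * q n (r + 4))) * e n (2 * l - 1 - r)) atTop (𝓝 0) := by
      have := tendsto_finsetSum (Finset.range (2 * l)) fun r hr =>
        ((hw (r + 4) (by omega)).const_mul (ℓ (r + 3))).mul (heven (2 * l - 1 - r) (by omega))
      simpa using this
    have h2 := (hw3.const_mul (ℓ 2)).mul (heven (2 * l) (by omega))
    rw [if_pos (by simp), show 2 * l / 2 = l by omega] at h2
    simpa using h1.add h2
  induction l with
  | zero =>
    have h1 := ((hrest 0 hl).add (tendsto_const_nhds (x := (0 : ℝ)))).div_const 3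
    have he1 : ∀ᶠ n in atTop, e n 1 = 0 := by
      filter_upwards [hrec 0 (by omega)] with n hn
      simpa [hℓ] using hn
    have hval : ℓ 2 * B / 3 * ((ℓ 1 * A / 2) ^ 0 / ((0 : ℕ).factorial : ℝ))
        = (ℓ 2 * B * ((ℓ 1 * A / 2) ^ 0 / ((0 : ℕ).factorial : ℝ)) + 0) / 3 := by ring
    rw [hval]
    refine h1.congr' ?_
    filter_upwards [hsplit 0 hl, he1] with n hn hn1
    rw [hn]
    simp [hn1]
  | succ l ih =>
    have h1 := ((hrest (l + 1) hl).add ((hq2.const_mul (ℓ 1)).mul (ih (by omega)))).div_const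
      (3 + 2 * ((l + 1 : ℕ) : ℝ))
    have hval : ℓ 2 * B / 3 * ((ℓ 1 * A / 2) ^ (l + 1) / ((l + 1).factorial : ℝ))
        = (ℓ 2 * B * ((ℓ 1 * A / 2) ^ (l + 1) / ((l + 1).factorial : ℝ))
          + ℓ 1 * A * (ℓ 2 * B / 3 * ((ℓ 1 * A / 2) ^ l / (l.factorial : ℝ))))
            / (3 + 2 * ((l + 1 : ℕ) : ℝ)) := by
      rw [Nat.factorial_succ]
      have : (l.factorial : ℝ) ≠ 0 := by positivity
      push_cast
      field_simp
      ring
    rw [hval]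
    refine h1.congr' ?_
    filter_upwards [hsplit (l + 1) hl] with n hn
    rw [hn, show 1 + 2 * (l + 1) = 3 + 2 * l by ring]

/-! ### Sums of regularly growing sequences -/

theorem tendsto_rpow_succ_sub_div (s : ℝ) :
    Tendsto (fun N : ℕ => (((N : ℝ) + 1) ^ (s + 1) - (N : ℝ) ^ (s + 1)) / (N : ℝ) ^ s) atTop
      (𝓝 (s + 1)) := by
  have hd : HasDerivAt (fun y : ℝ => (1 + y) ^ (s + 1)) (s + 1) 0 := by
    have h1 : HasDerivAt (fun y : ℝ => 1 + y) 1 0 := (hasDerivAt_id 0).const_add 1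
    have := h1.rpow_const (p := s + 1) (Or.inl (by norm_num))
    simpa using this
  have h2 := hd.tendsto_slope_zero_right
  have h3 : Tendsto (fun N : ℕ => ((N : ℝ))⁻¹) atTop (𝓝[>] 0) :=
    tendsto_inv_atTop_nhdsGT_zero.comp tendsto_natCast_atTop_atTop
  refine (h2.comp h3).congr' ?_
  filter_upwards [eventually_gt_atTop 0] with N hN
  have hN' : (0 : ℝ) < N := by exact_mod_cast hN
  simp only [Function.comp, inv_inv, zero_add, add_zero, Real.one_rpow, smul_eq_mul]
  have e1 : (N : ℝ) + 1 = N * (1 + (N : ℝ)⁻¹) := by field_simp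
  rw [e1, Real.mul_rpow hN'.le (by positivity), Real.rpow_add_one hN'.ne' s]
  have : (N : ℝ) ^ s ≠ 0 := by positivity
  field_simp

/-- The Cesàro theorem for power weights: if `u N / N ^ s` tends to `L`, where `s > -1`, then
the sum of the first `n` terms, divided by `n ^ (s + 1)`, tends to `L / (s + 1)`. -/
theorem tendsto_sum_range_div_rpow {u : ℕ → ℝ} {s L : ℝ} (hs : 0 < s + 1)
    (hu : Tendsto (fun N : ℕ => u N / (N : ℝ) ^ s) atTop (𝓝 L)) :
    Tendsto (fun n : ℕ => (∑ N ∈ Finset.range n, u N) / (n : ℝ) ^ (s + 1)) atTop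
      (𝓝 (L / (s + 1))) := by
  set g : ℕ → ℝ := fun N => ((N : ℝ) + 1) ^ (s + 1) - (N : ℝ) ^ (s + 1) with hg
  have hgpos : ∀ N, 0 < g N := fun N =>
    sub_pos.mpr (Real.rpow_lt_rpow (by positivity) (by linarith) hs)
  have hgsum : ∀ n : ℕ, ∑ N ∈ Finset.range n, g N = (n : ℝ) ^ (s + 1) := by
    intro n
    have := Finset.sum_range_sub (fun N : ℕ => (N : ℝ) ^ (s + 1)) n
    simp only [Nat.cast_add, Nat.cast_one, Nat.cast_zero] at this
    rw [hg, this, Real.zero_rpow hs.ne', sub_zero]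
  have hlittle : (fun N => u N - L / (s + 1) * g N) =o[atTop] g := by
    rw [isLittleO_iff_tendsto fun N h => absurd h (hgpos N).ne']
    have h1 := (hu.div (tendsto_rpow_succ_sub_div s) hs.ne').sub_const (L / (s + 1))
    rw [sub_self] at h1
    refine h1.congr' ?_
    filter_upwards [eventually_gt_atTop 0] with N hN
    have hN' : (0 : ℝ) < N := by exact_mod_cast hN
    have h2 : (N : ℝ) ^ s ≠ 0 := by positivity
    have h3 := (hgpos N).ne'
    change u N / (N : ℝ) ^ s / (g N / (N : ℝ) ^ s) - _ = _
    field_simp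
  have hdiv : Tendsto (fun n : ℕ => ∑ N ∈ Finset.range n, g N) atTop atTop := by
    simp_rw [hgsum]
    exact (tendsto_rpow_atTop hs).comp tendsto_natCast_atTop_atTop
  have h4 := (hlittle.sum_range (fun N => (hgpos N).le) hdiv).tendsto_div_nhds_zero
  have h5 := h4.add_const (L / (s + 1))
  rw [zero_add] at h5
  refine h5.congr' ?_
  filter_upwards [eventually_gt_atTop 0] with n hn
  have hn' : (0 : ℝ) < n := by exact_mod_cast hn
  have h2 : (n : ℝ) ^ (s + 1) ≠ 0 := by positivity
  rw [Finset.sum_sub_distrib, ← Finset.mul_sum, hgsum]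
  field_simp
  ring

/-! ### Growth of the partial sums of the coefficients -/

theorem HasMemory.nonneg {a : ℕ → ℝ} {d c : ℝ} (h : HasMemory a d c) : 0 ≤ d := by
  rcases h with ⟨rfl, -⟩ | ⟨h, -⟩
  · exact le_rfl
  · exact h.le

theorem HasMemory.lt_half {a : ℕ → ℝ} {d c : ℝ} (h : HasMemory a d c) : d < 1 / 2 := by
  rcases h with ⟨rfl, -⟩ | ⟨-, h, -⟩
  · norm_num
  · exact h

theorem tendsto_coeff_div_rpow {a : ℕ → ℝ} {d c : ℝ} (hc : 0 < c)
    (h : a ~[atTop] fun i : ℕ => c * (i : ℝ) ^ (d - 1)) :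
    Tendsto (fun i : ℕ => a i / (i : ℝ) ^ (d - 1)) atTop (𝓝 c) := by
  have hne : ∀ᶠ i : ℕ in atTop, c * (i : ℝ) ^ (d - 1) ≠ 0 := by
    filter_upwards [eventually_gt_atTop 0] with i hi
    have hi' : (0 : ℝ) < i := by exact_mod_cast hi
    positivity
  have h1 := ((isEquivalent_iff_tendsto_one hne).mp h).const_mul c
  rw [mul_one] at h1
  refine h1.congr' ?_
  filter_upwards [hne] with i hi
  have h2 : (i : ℝ) ^ (d - 1) ≠ 0 := right_ne_zero_of_mul hi
  simp only [Pi.div_apply]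
  field_simp

/-- In both memory regimes the partial sums of the coefficients grow like `m(d) * n ^ d`. -/
theorem HasMemory.tendsto_coeffSum_div_rpow {a : ℕ → ℝ} {d c : ℝ} (h : HasMemory a d c) :
    Tendsto (fun n : ℕ => (∑ i ∈ Finset.range (n + 1), a i) / (n : ℝ) ^ d) atTop
      (𝓝 (memoryConst a d c)) := by
  rcases h with ⟨rfl, h⟩ | ⟨hd, -, hc, h⟩
  · simp only [Real.rpow_zero, div_one, memoryConst, if_true]
    exact (Summable.of_abs h).hasSum.tendsto_sum_nat.comp (tendsto_add_atTop_nat 1)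
  · rw [memoryConst, if_neg hd.ne']
    have h1 := tendsto_coeff_div_rpow hc h
    have h2 := tendsto_sum_range_div_rpow (s := d - 1) (by linarith) h1
    have h3 := h1.mul tendsto_inv_atTop_nhds_zero_nat
    rw [mul_zero] at h3
    rw [sub_add_cancel] at h2
    have h4 := h2.add h3
    rw [add_zero] at h4
    refine h4.congr' ?_
    filter_upwards [eventually_gt_atTop 0] with n hn
    have hn' : (0 : ℝ) < n := by exact_mod_cast hn
    rw [Finset.sum_range_succ, add_div, Real.rpow_sub_one hn'.ne']
    have h2 : (n : ℝ) ^ d ≠ 0 := by positivity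
    congr 1
    field_simp

theorem tendsto_coeffSum_comp_div_rpow {B : ℕ → ℝ} {d m : ℝ} (hd : 0 ≤ d)
    (hB : Tendsto (fun n : ℕ => B n / (n : ℝ) ^ d) atTop (𝓝 m)) {k : ℕ → ℕ} {y : ℝ}
    (hk : Tendsto k atTop atTop) (hy : Tendsto (fun n => (k n : ℝ) / n) atTop (𝓝 y)) :
    Tendsto (fun n : ℕ => B (k n) / (n : ℝ) ^ d) atTop (𝓝 (m * y ^ d)) := by
  have h1 := (hB.comp hk).mul (hy.rpow_const (p := d) (Or.inr hd))
  refine h1.congr' ?_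
  filter_upwards [eventually_gt_atTop 0, hk.eventually_gt_atTop 0] with n hn hkn
  have hn' : (0 : ℝ) < n := by exact_mod_cast hn
  have hk' : (0 : ℝ) < k n := by exact_mod_cast hkn
  simp only [Function.comp]
  rw [Real.div_rpow hk'.le hn'.le]
  have h2 : (n : ℝ) ^ d ≠ 0 := by positivity
  have h3 : (k n : ℝ) ^ d ≠ 0 := by positivity
  field_simp

/-! ### The kernel `(1 + x) ^ d - x ^ d` -/

/-- The function `1` on `x ≤ 1` and `x ^ (2 * (d - 1))` beyond, which dominates the powers of
order at least two of the kernel and of its discrete approximations. -/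
noncomputable def kernelBound (d x : ℝ) : ℝ := if x ≤ 1 then 1 else x ^ (2 * (d - 1))

theorem integrableOn_kernelBound {d : ℝ} (hd : d < 1 / 2) :
    IntegrableOn (kernelBound d) (Set.Ioi 0) := by
  rw [← Set.Ioc_union_Ioi_eq_Ioi zero_le_one, integrableOn_union]
  constructor
  · refine (integrableOn_const (C := (1 : ℝ)) (by simp)).congr_fun (fun x hx => ?_)
      measurableSet_Ioc
    simp [kernelBound, hx.2]
  · refine (integrableOn_Ioi_rpow_of_lt (a := 2 * (d - 1)) (by linarith) one_pos).congr_fun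
      (fun x hx => ?_) measurableSet_Ioi
    simp [kernelBound, not_le.mpr (Set.mem_Ioi.mp hx)]

theorem abs_pow_le_kernelBound {d C x y : ℝ} (hd : d < 1) (hC : 0 ≤ C) (hx : 0 < x)
    (h1 : |y| ≤ C) (h2 : |y| ≤ C * x ^ (d - 1)) {r : ℕ} (hr : 2 ≤ r) :
    |y| ^ r ≤ C ^ r * kernelBound d x := by
  rw [kernelBound]
  split_ifs with h
  · rw [mul_one]
    exact pow_le_pow_left₀ (abs_nonneg _) h1 r
  · have h3 : x ^ (d - 1) ≤ 1 := Real.rpow_le_one_of_one_le_of_nonpos (not_le.mp h).le (by linarith)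
    calc |y| ^ r ≤ (C * x ^ (d - 1)) ^ r := pow_le_pow_left₀ (abs_nonneg _) h2 r
      _ = C ^ r * (x ^ (d - 1)) ^ r := mul_pow _ _ _
      _ ≤ C ^ r * (x ^ (d - 1)) ^ 2 := by
          gcongr C ^ r * ?_
          exact pow_le_pow_of_le_one (by positivity) h3 hr
      _ = C ^ r * x ^ (2 * (d - 1)) := by
          rw [← Real.rpow_natCast (x ^ (d - 1)), ← Real.rpow_mul hx.le]
          norm_num [mul_comm]

theorem integrableOn_kernel_pow {d : ℝ} (hd0 : 0 ≤ d) (hd : d < 1 / 2) {r : ℕ} (hr : 2 ≤ r) :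
    IntegrableOn (fun x : ℝ => ((1 + x) ^ d - x ^ d) ^ r) (Set.Ioi 0) := by
  refine ((integrableOn_kernelBound hd).const_mul (1 ^ r)).mono' ?_ ?_
  · exact Measurable.aestronglyMeasurable (by fun_prop)
  · filter_upwards [ae_restrict_mem measurableSet_Ioi] with x hx
    have hx : 0 < x := hx
    have h0 : 0 ≤ (1 + x) ^ d - x ^ d :=
      sub_nonneg.mpr (Real.rpow_le_rpow hx.le (by linarith) hd0)
    rw [norm_pow, Real.norm_eq_abs]
    refine abs_pow_le_kernelBound (by linarith) zero_le_one hx ?_ ?_ hr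
    · rw [abs_of_nonneg h0]
      have := Real.rpow_add_le_add_rpow zero_le_one hx.le hd0 (by linarith : d ≤ 1)
      rw [Real.one_rpow] at this
      linarith
    · rw [abs_of_nonneg h0, one_mul]
      have h1 := rpow_one_add_le_one_add_mul_self (s := 1 / x) (p := d)
        (by have : 0 < 1 / x := by positivity
            linarith) hd0 (by linarith)
      have e1 : 1 + x = x * (1 + 1 / x) := by field_simp; ring
      rw [e1, Real.mul_rpow hx.le (by positivity), Real.rpow_sub_one hx.ne']
      have hxd : 0 < x ^ d := by positivity
      calc x ^ d * (1 + 1 / x) ^ d - x ^ d ≤ x ^ d * (1 + d * (1 / x)) - x ^ d := by gcongr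
        _ = d * (x ^ d / x) := by field_simp; ring
        _ ≤ 1 * (x ^ d / x) := by gcongr; linarith
        _ = x ^ d / x := one_mul _

/-! ### Power sums of the coefficients of the partial sums -/

theorem windowSum_of_lt (a : ℕ → ℝ) {n N : ℕ} (hN : N < n) :
    windowSum a n N = ∑ i ∈ Finset.range (N + 1), a i := by
  rw [← Finset.sum_range_reflect, windowSum]
  refine (Finset.sum_subset (Finset.range_mono hN) fun s _ hs => ?_).symm.trans
    (Finset.sum_congr rfl fun s hs => ?_)
  · rw [Finset.mem_range, not_lt] at hs
    rw [if_neg (by omega)]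
  · rw [Finset.mem_range] at hs
    rw [if_pos (by omega)]
    congr 1

theorem windowSum_add (a : ℕ → ℝ) (n j : ℕ) :
    windowSum a n (j + n) = ∑ i ∈ Finset.range n, a (i + (j + 1)) := by
  rw [← Finset.sum_range_reflect, windowSum]
  refine Finset.sum_congr rfl fun s hs => ?_
  rw [Finset.mem_range] at hs
  rw [if_pos (by omega)]
  congr 1
  omega

theorem windowSum_add_eq_sub (a : ℕ → ℝ) (n j : ℕ) :
    windowSum a n (j + n) =
      ∑ i ∈ Finset.range (n + j + 1), a i - ∑ i ∈ Finset.range (j + 1), a i := by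
  rw [windowSum_add, show n + j + 1 = (j + 1) + n by ring, Finset.sum_range_add,
    add_sub_cancel_left]
  refine Finset.sum_congr rfl fun i _ => ?_
  rw [add_comm i]

/-- The part of the power sum coming from the noise variables within the observation window. -/
theorem tendsto_sum_windowSum_pow_of_lt {a : ℕ → ℝ} {d c : ℝ} (h : HasMemory a d c) (r : ℕ) :
    Tendsto (fun n : ℕ => (∑ N ∈ Finset.range n, windowSum a n N ^ r) / (n : ℝ) ^ (1 + r * d))
      atTop (𝓝 (memoryConst a d c ^ r * (1 / (1 + r * d)))) := by
  have hd := h.nonneg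
  have h1 := h.tendsto_coeffSum_div_rpow.pow r
  have h2 := tendsto_sum_range_div_rpow (u := fun N => (∑ i ∈ Finset.range (N + 1), a i) ^ r)
    (s := r * d) (L := memoryConst a d c ^ r) (by positivity) (h1.congr fun N => by
      rw [div_pow, ← Real.rpow_natCast ((N : ℝ) ^ d), ← Real.rpow_mul (Nat.cast_nonneg N),
        mul_comm d])
  rw [mul_one_div, add_comm (1 : ℝ)]
  refine h2.congr fun n => ?_
  congr 1
  exact Finset.sum_congr rfl fun N hN => by rw [windowSum_of_lt a (Finset.mem_range.mp hN)]

/-- A step function on the cells `[j / n, (j + 1) / n)` integrates to a Riemann sum. -/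
theorem setIntegral_floor_mul {F : ℕ → ℝ} {n : ℕ} (hn : 0 < n)
    (hF : IntegrableOn (fun x : ℝ => F ⌊(n : ℝ) * x⌋₊) (Set.Ioi 0)) :
    ∫ x in Set.Ioi (0 : ℝ), F ⌊(n : ℝ) * x⌋₊ = (∑' j, F j) / n := by
  have hn' : (0 : ℝ) < n := by exact_mod_cast hn
  set s : ℕ → Set ℝ := fun j => Set.Ico ((j : ℝ) / n) (((j : ℝ) + 1) / n) with hs
  have hmem : ∀ j x, x ∈ s j ↔ 0 ≤ x ∧ ⌊(n : ℝ) * x⌋₊ = j := by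
    intro j x
    simp only [hs, Set.mem_Ico, div_le_iff₀ hn', lt_div_iff₀ hn']
    constructor
    · rintro ⟨h1, h2⟩
      have hx : 0 ≤ x := by
        by_contra hx
        have : (0 : ℝ) ≤ j := Nat.cast_nonneg j
        nlinarith [mul_neg_of_neg_of_pos (not_le.mp hx) hn']
      refine ⟨hx, (Nat.floor_eq_iff (by positivity)).mpr ⟨by linarith, by linarith⟩⟩
    · rintro ⟨hx, h⟩
      have := (Nat.floor_eq_iff (by positivity)).mp h
      exact ⟨by linarith [this.1], by linarith [this.2]⟩
  have hU : ⋃ j, s j = Set.Ici 0 := by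
    ext x
    simp only [Set.mem_iUnion, hmem, Set.mem_Ici]
    exact ⟨fun ⟨_, h, _⟩ => h, fun h => ⟨_, h, rfl⟩⟩
  rw [← integral_Ici_eq_integral_Ioi, ← hU, integral_iUnion (fun j => measurableSet_Ico)
    (fun i j hij => Set.disjoint_left.mpr fun x hi hj => hij
      (((hmem i x).mp hi).2.symm.trans ((hmem j x).mp hj).2))
    (by rw [hU, integrableOn_Ici_iff_integrableOn_Ioi]; exact hF), ← tsum_div_const]
  refine tsum_congr fun j => ?_
  rw [setIntegral_congr_fun measurableSet_Ico
    (fun x hx => by rw [((hmem j x).mp hx).2] : Set.EqOn _ (fun _ => F j) (s j)),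
    setIntegral_const]
  have : volume.real (s j) = 1 / n := by
    rw [hs, Real.volume_real_Ico_of_le (by gcongr; linarith)]
    ring
  rw [this, smul_eq_mul]
  ring

theorem sum_range_succ_rpow_le {d : ℝ} (hd0 : 0 < d) (hd1 : d ≤ 1) (n : ℕ) :
    ∑ i ∈ Finset.range n, ((i : ℝ) + 1) ^ (d - 1) ≤ (n : ℝ) ^ d / d := by
  have h1 : ∀ i : ℕ, ((i : ℝ) + 1) ^ (d - 1) ≤
      (((i + 1 : ℕ) : ℝ) ^ d - (i : ℝ) ^ d) / d := by
    intro i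
    have hi : (0 : ℝ) < (i : ℝ) + 1 := by positivity
    have h2 := rpow_one_add_le_one_add_mul_self (s := -(1 / ((i : ℝ) + 1))) (p := d)
      (by rw [neg_le_neg_iff, div_le_one hi]; linarith [(Nat.cast_nonneg i : (0 : ℝ) ≤ i)])
      hd0.le hd1
    have e1 : (i : ℝ) = ((i : ℝ) + 1) * (1 + -(1 / ((i : ℝ) + 1))) := by field_simp; ring
    have h3 : (i : ℝ) ^ d ≤ ((i : ℝ) + 1) ^ d * (1 + d * -(1 / ((i : ℝ) + 1))) := by
      conv_lhs => rw [e1]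
      have h5 : 0 ≤ 1 + -(1 / ((i : ℝ) + 1)) := by
        have : 1 + -(1 / ((i : ℝ) + 1)) = (i : ℝ) / (i + 1) := by field_simp; ring
        rw [this]; positivity
      rw [Real.mul_rpow hi.le h5]
      gcongr
    rw [le_div_iff₀ hd0, Real.rpow_sub_one hi.ne']
    have h4 : ((i : ℝ) + 1) ^ d * (1 + d * -(1 / ((i : ℝ) + 1)))
        = ((i : ℝ) + 1) ^ d - ((i : ℝ) + 1) ^ d / ((i : ℝ) + 1) * d := by ring
    push_cast
    linarith
  refine (Finset.sum_le_sum fun i _ => h1 i).trans (le_of_eq ?_)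
  rw [← Finset.sum_div, Finset.sum_range_sub fun i : ℕ => (i : ℝ) ^ d]
  simp [Real.zero_rpow hd0.ne']

/-- The contribution of the noise before the observation window under short memory: it is
negligible, being bounded by a Cesàro mean of tails of `∑ |a i|`. -/
theorem tendsto_tsum_windowSum_pow_short {a : ℕ → ℝ} (ha : Summable fun i => |a i|) {r : ℕ}
    (hr : 1 ≤ r) :
    Tendsto (fun n : ℕ => (∑' j, windowSum a n (j + n) ^ r) / (n : ℝ)) atTop (𝓝 0) := by
  obtain ⟨r, rfl⟩ : ∃ q, r = q + 1 := ⟨r - 1, by omega⟩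
  set G := ∑' i, |a i| with hG
  have hshift : ∀ m, Summable fun j => |a (j + m)| := fun m => (summable_nat_add_iff m).mpr ha
  have hle : ∀ n j, |windowSum a n (j + n)| ≤ ∑ i ∈ Finset.range n, |a (j + (i + 1))| := by
    intro n j
    rw [windowSum_add]
    refine (Finset.abs_sum_le_sum_abs _ _).trans (le_of_eq ?_)
    exact Finset.sum_congr rfl fun i _ => by rw [show i + (j + 1) = j + (i + 1) by ring]
  have hleG : ∀ n j, |windowSum a n (j + n)| ≤ G := by
    intro n j
    rw [windowSum_add]
    refine (Finset.abs_sum_le_sum_abs _ _).trans ?_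
    refine ((hshift (j + 1)).sum_le_tsum _ fun _ _ => abs_nonneg _).trans ?_
    rw [hG, ← ha.sum_add_tsum_nat_add (j + 1)]
    exact le_add_of_nonneg_left (Finset.sum_nonneg fun _ _ => abs_nonneg _)
  have hG0 : 0 ≤ G := tsum_nonneg fun _ => abs_nonneg _
  have hsum : ∀ n, Summable fun j => ∑ i ∈ Finset.range n, |a (j + (i + 1))| := fun n =>
    summable_sum fun i _ => hshift (i + 1)
  have hpow : ∀ n j, |windowSum a n (j + n) ^ (r + 1)| ≤
      G ^ r * ∑ i ∈ Finset.range n, |a (j + (i + 1))| := by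
    intro n j
    rw [abs_pow, pow_succ]
    exact mul_le_mul (pow_le_pow_left₀ (abs_nonneg _) (hleG n j) r) (hle n j) (abs_nonneg _)
      (by positivity)
  have hbound : ∀ n : ℕ, |∑' j, windowSum a n (j + n) ^ (r + 1)| ≤
      G ^ r * ∑ i ∈ Finset.range n, ∑' j, |a (j + (i + 1))| := by
    intro n
    have := tsum_of_norm_bounded (f := fun j => windowSum a n (j + n) ^ (r + 1))
      ((hsum n).mul_left (G ^ r)).hasSum (hpow n)
    rwa [tsum_mul_left, Summable.tsum_finsetSum fun i _ => hshift (i + 1)] at this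
  have htail : Tendsto (fun i : ℕ => ∑' j, |a (j + (i + 1))|) atTop (𝓝 0) :=
    (tendsto_sum_nat_add fun i => |a i|).comp (tendsto_add_atTop_nat 1)
  have hces := htail.cesaro.const_mul (G ^ r)
  rw [mul_zero] at hces
  refine squeeze_zero_norm (fun n => ?_) hces
  rw [norm_div, Real.norm_eq_abs, Real.norm_of_nonneg (Nat.cast_nonneg n), div_eq_inv_mul]
  calc _ ≤ (n : ℝ)⁻¹ * (G ^ r * ∑ i ∈ Finset.range n, ∑' j, |a (j + (i + 1))|) := by
        gcongr
        exact hbound n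
    _ = _ := by ring

theorem exists_abs_coeff_le {a : ℕ → ℝ} {d c : ℝ}
    (h : a ~[atTop] fun i : ℕ => c * (i : ℝ) ^ (d - 1)) :
    ∃ C : ℝ, 0 < C ∧ ∀ i, 1 ≤ i → |a i| ≤ C * (i : ℝ) ^ (d - 1) := by
  have h1 : a =O[atTop] fun i : ℕ => (i : ℝ) ^ (d - 1) :=
    h.isBigO.trans (isBigO_const_mul_self c _ _)
  obtain ⟨C, hC, hb⟩ := bound_of_isBigO_nat_atTop h1
  refine ⟨C, hC, fun i hi => ?_⟩
  have hi' : (0 : ℝ) < i := by exact_mod_cast hi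
  have := hb (x := i) (by positivity)
  rwa [Real.norm_eq_abs, Real.norm_of_nonneg (by positivity)] at this

/-- The contribution of the noise before the observation window under long memory: a Riemann sum
for the integral of a power of the kernel, the convergence being dominated. -/
theorem tendsto_tsum_windowSum_pow_long {a : ℕ → ℝ} {d c : ℝ} (hmem : HasMemory a d c)
    (hd0 : 0 < d) (ha : a ~[atTop] fun i : ℕ => c * (i : ℝ) ^ (d - 1)) {r : ℕ} (hr : 2 ≤ r) :
    Tendsto (fun n : ℕ => (∑' j, windowSum a n (j + n) ^ r) / (n : ℝ) ^ (1 + r * d)) atTop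
      (𝓝 (memoryConst a d c ^ r * ∫ x in Set.Ioi (0 : ℝ), ((1 + x) ^ d - x ^ d) ^ r)) := by
  have hd := hmem.lt_half
  obtain ⟨C, hC, hcoeff⟩ := exists_abs_coeff_le ha
  have hCd : C ≤ C / d := by rw [le_div_iff₀ hd0]; nlinarith
  set f : ℕ → ℝ → ℝ := fun n x => windowSum a n (⌊(n : ℝ) * x⌋₊ + n) / (n : ℝ) ^ d with hf
  have hfm : ∀ n, Measurable (f n) := fun n =>
    ((measurable_from_nat (f := fun j => windowSum a n (j + n))).comp
      (Nat.measurable_floor.comp (measurable_const_mul _))).div_const _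
  have hterm : ∀ i j : ℕ, |a (i + (j + 1))| ≤ C * ((i : ℝ) + (j + 1)) ^ (d - 1) := by
    intro i j
    have := hcoeff (i + (j + 1)) (by omega)
    push_cast at this
    exact this
  have hbound : ∀ n : ℕ, 0 < n → ∀ x : ℝ, 0 < x →
      |f n x ^ r| ≤ (C / d) ^ r * kernelBound d x := by
    intro n hn x hx
    have hn' : (0 : ℝ) < n := by exact_mod_cast hn
    have hnd : (0 : ℝ) < (n : ℝ) ^ d := by positivity
    rw [abs_pow]
    have hsum : |f n x| ≤ (∑ i ∈ Finset.range n,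
        C * ((i : ℝ) + (⌊(n : ℝ) * x⌋₊ + 1)) ^ (d - 1)) / (n : ℝ) ^ d := by
      rw [hf, abs_div, abs_of_pos hnd, windowSum_add]
      gcongr
      exact (Finset.abs_sum_le_sum_abs _ _).trans (Finset.sum_le_sum fun i _ => hterm i _)
    refine abs_pow_le_kernelBound (by linarith) (by positivity) hx (hsum.trans ?_)
      (hsum.trans ?_) hr
    · rw [div_le_iff₀ hnd, ← Finset.mul_sum]
      have h1 : ∑ i ∈ Finset.range n, ((i : ℝ) + (⌊(n : ℝ) * x⌋₊ + 1)) ^ (d - 1) ≤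
          ∑ i ∈ Finset.range n, ((i : ℝ) + 1) ^ (d - 1) := by
        refine Finset.sum_le_sum fun i _ => ?_
        refine Real.rpow_le_rpow_of_nonpos (by positivity) ?_ (by linarith)
        linarith [(Nat.cast_nonneg ⌊(n : ℝ) * x⌋₊ : (0 : ℝ) ≤ ⌊(n : ℝ) * x⌋₊)]
      calc _ ≤ C * ((n : ℝ) ^ d / d) := by
            gcongr
            exact h1.trans (sum_range_succ_rpow_le hd0 (by linarith) n)
        _ = _ := by ring
    · have h1 : ∀ i : ℕ, C * ((i : ℝ) + (⌊(n : ℝ) * x⌋₊ + 1)) ^ (d - 1) ≤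
          C * ((n : ℝ) * x) ^ (d - 1) := by
        intro i
        gcongr ?_ * ?_
        refine Real.rpow_le_rpow_of_nonpos (by positivity) ?_ (by linarith)
        linarith [(Nat.lt_floor_add_one ((n : ℝ) * x)).le, (Nat.cast_nonneg i : (0 : ℝ) ≤ i)]
      rw [div_le_iff₀ hnd]
      refine (Finset.sum_le_sum fun i _ => h1 i).trans ?_
      rw [Finset.sum_const, Finset.card_range, nsmul_eq_mul, Real.mul_rpow hn'.le hx.le,
        Real.rpow_sub_one hn'.ne']
      calc (n : ℝ) * (C * ((n : ℝ) ^ d / n * x ^ (d - 1))) = C * x ^ (d - 1) * (n : ℝ) ^ d := by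
            field_simp
        _ ≤ _ := by gcongr
  have hlim : ∀ x : ℝ, 0 < x → Tendsto (fun n => f n x ^ r) atTop
      (𝓝 ((memoryConst a d c * ((1 + x) ^ d - x ^ d)) ^ r)) := by
    intro x hx
    refine Tendsto.pow ?_ r
    have hB := hmem.tendsto_coeffSum_div_rpow
    have hfloor : Tendsto (fun n : ℕ => ⌊(n : ℝ) * x⌋₊) atTop atTop :=
      tendsto_nat_floor_atTop.comp
        (tendsto_natCast_atTop_atTop.atTop_mul_const hx)
    have hfloor' : Tendsto (fun n : ℕ => (⌊(n : ℝ) * x⌋₊ : ℝ) / n) atTop (𝓝 x) := by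
      have := (tendsto_nat_floor_mul_div_atTop hx.le).comp
        (tendsto_natCast_atTop_atTop (R := ℝ))
      simpa [Function.comp_def, mul_comm x] using this
    have h1 := tendsto_coeffSum_comp_div_rpow hd0.le hB hfloor hfloor'
    have h2 := tendsto_coeffSum_comp_div_rpow (k := fun n => n + ⌊(n : ℝ) * x⌋₊) (y := 1 + x)
      hd0.le hB (tendsto_atTop_mono (fun n => Nat.le_add_right n _) tendsto_id) (by
        refine (hfloor'.const_add 1).congr' ?_
        filter_upwards [eventually_gt_atTop 0] with n hn
        have hn' : (0 : ℝ) < n := by exact_mod_cast hn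
        push_cast
        field_simp)
    rw [mul_sub]
    refine (h2.sub h1).congr fun n => ?_
    simp only [hf]
    rw [windowSum_add_eq_sub, sub_div]
  have hdom : Tendsto (fun n : ℕ => ∫ x in Set.Ioi (0 : ℝ), f (n + 1) x ^ r) atTop
      (𝓝 (∫ x in Set.Ioi (0 : ℝ), (memoryConst a d c * ((1 + x) ^ d - x ^ d)) ^ r)) := by
    refine tendsto_integral_of_dominated_convergence (fun x => (C / d) ^ r * kernelBound d x)
      (fun n => ((hfm _).pow_const r).aestronglyMeasurable)
      ((integrableOn_kernelBound hd).const_mul _) (fun n => ?_) ?_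
    · filter_upwards [ae_restrict_mem measurableSet_Ioi] with x hx
      exact hbound (n + 1) (by omega) x hx
    · filter_upwards [ae_restrict_mem measurableSet_Ioi] with x hx
      exact (tendsto_add_atTop_iff_nat (f := fun n => f n x ^ r) 1).mpr (hlim x hx)
  rw [tendsto_add_atTop_iff_nat (f := fun n => ∫ x in Set.Ioi (0 : ℝ), f n x ^ r) 1] at hdom
  simp_rw [mul_pow] at hdom
  rw [integral_const_mul] at hdom
  refine hdom.congr' ?_
  filter_upwards [eventually_gt_atTop 0] with n hn
  have hn' : (0 : ℝ) < n := by exact_mod_cast hn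
  have hint : IntegrableOn (fun x => f n x ^ r) (Set.Ioi 0) := by
    refine ((integrableOn_kernelBound hd).const_mul ((C / d) ^ r)).mono'
      ((hfm _).pow_const r).aestronglyMeasurable ?_
    filter_upwards [ae_restrict_mem measurableSet_Ioi] with x hx
    exact hbound n hn x hx
  have h1 := setIntegral_floor_mul
    (F := fun j => (windowSum a n (j + n) / (n : ℝ) ^ d) ^ r) hn hint
  rw [h1]
  simp_rw [div_pow]
  rw [tsum_div_const, div_div, Real.rpow_add hn', Real.rpow_one, mul_comm (n : ℝ),
    ← Real.rpow_natCast ((n : ℝ) ^ d), ← Real.rpow_mul hn'.le, mul_comm d]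

/-- The asymptotics of the power sums of the coefficients of `S_n`, in both memory regimes. -/
theorem tendsto_powerSum_div_rpow {a : ℕ → ℝ} {d c : ℝ} (h : HasMemory a d c)
    (ha : Summable fun i => a i ^ 2) {r : ℕ} (hr : 2 ≤ r) :
    Tendsto (fun n : ℕ => (∑' N, windowSum a n N ^ r) / (n : ℝ) ^ (1 + r * d)) atTop
      (𝓝 (memoryConst a d c ^ r * integralFactor d r)) := by
  have htail : Tendsto (fun n : ℕ => (∑' j, windowSum a n (j + n) ^ r) / (n : ℝ) ^ (1 + r * d))
      atTop (𝓝 (memoryConst a d c ^ r *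
        ∫ x in Set.Ioi (0 : ℝ), ((1 + x) ^ d - x ^ d) ^ r)) := by
    rcases h with ⟨rfl, hs⟩ | ⟨hd0, hd, hc, hl⟩
    · have := tendsto_tsum_windowSum_pow_short hs (r := r) (by omega)
      simpa [zero_pow (by omega : r ≠ 0)] using this
    · exact tendsto_tsum_windowSum_pow_long (Or.inr ⟨hd0, hd, hc, hl⟩) hd0 hl hr
  rw [integralFactor, mul_add]
  refine ((tendsto_sum_windowSum_pow_of_lt h r).add htail).congr fun n => ?_
  have hsum : Summable fun N => windowSum a n N ^ r :=
    Summable.of_abs (by simpa only [abs_pow] using summable_abs_windowSum_pow ha n hr)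
  rw [← add_div, hsum.sum_add_tsum_nat_add n]

/-! ### Moments of the normalised partial sums -/

/-- The order of magnitude of the power sums relative to that of the standard deviation: blocks
of size `r` contribute a factor `n ^ (1 - r / 2)`. -/
theorem tendsto_powerSum_normalized {a : ℕ → ℝ} {d c : ℝ} (h : HasMemory a d c)
    (ha : Summable fun i => a i ^ 2) {r : ℕ} (hr : 2 ≤ r) {s L : ℝ}
    (hs : Tendsto (fun n : ℕ => (n : ℝ) ^ (s + (1 - (r : ℝ) / 2))) atTop (𝓝 L)) :
    Tendsto (fun n : ℕ => (n : ℝ) ^ s *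
      ((∑' N, windowSum a n N ^ r) / ((n : ℝ) ^ (1 / 2 + d)) ^ r)) atTop
      (𝓝 (L * (memoryConst a d c ^ r * integralFactor d r))) := by
  refine (hs.mul (tendsto_powerSum_div_rpow h ha hr)).congr' ?_
  filter_upwards [eventually_gt_atTop 0] with n hn
  have hn' : (0 : ℝ) < n := by exact_mod_cast hn
  rw [← Real.rpow_natCast ((n : ℝ) ^ (1 / 2 + d)), ← Real.rpow_mul hn'.le, Real.rpow_add hn',
    show (1 / 2 + d) * (r : ℝ) = (1 + r * d) - (1 - (r : ℝ) / 2) by ring,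
    Real.rpow_sub hn' (1 + r * d)]
  have h1 : (n : ℝ) ^ (1 + (r : ℝ) * d) ≠ 0 := by positivity
  have h2 : (n : ℝ) ^ (1 - (r : ℝ) / 2) ≠ 0 := by positivity
  field_simp

theorem tendsto_natCast_rpow_of_neg {s : ℝ} (hs : s < 0) :
    Tendsto (fun n : ℕ => (n : ℝ) ^ s) atTop (𝓝 0) := by
  have := (tendsto_rpow_neg_atTop (y := -s) (by linarith)).comp
    (tendsto_natCast_atTop_atTop (R := ℝ))
  simpa [Function.comp_def] using this

section Main

variable {Ω : Type*} [MeasurableSpace Ω] {P : Measure Ω}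
  {a : ℕ → ℝ} {ε : ℤ → Ω → ℝ} {X : ℕ → Ω → ℝ} {σ d c : ℝ}

/-- The moment of `S_n / n ^ (1 / 2 + d)` of order `r`, divided by `r!`. -/
noncomputable def normalizedMoment (P : Measure Ω) (X : ℕ → Ω → ℝ) (d : ℝ) (n r : ℕ) : ℝ :=
  (∫ ω, partialSum X n ω ^ r ∂P) / (r.factorial : ℝ) / ((n : ℝ) ^ (1 / 2 + d)) ^ r

theorem normalizedMoment_recursion [IsProbabilityMeasure P] (hε : IsIIDWhiteNoise P ε σ)
    (hX : IsLinearProcess P a ε X)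
    {K : ℕ} (hK : MemLp (ε 1) (K : ℝ≥0∞) P) (hK2 : 2 ≤ K) (d : ℝ) (n : ℕ) {j : ℕ}
    (hj : j + 1 ≤ K) :
    ((j : ℝ) + 1) * normalizedMoment P X d n (j + 1) =
      ∑ r ∈ Finset.range (j + 1), (logDerivCoeff (fun s => ∫ ω, ε 1 ω ^ s ∂P) r
        * ((∑' N, windowSum a n N ^ (r + 1)) / ((n : ℝ) ^ (1 / 2 + d)) ^ (r + 1)))
        * normalizedMoment P X d n (j - r) := by
  rw [normalizedMoment, ← mul_div_assoc, partialSum_moment_recursion hε hX hK hK2 n hj,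
    Finset.sum_div]
  refine Finset.sum_congr rfl fun r hr => ?_
  rw [Finset.mem_range] at hr
  have hpow : ((n : ℝ) ^ (1 / 2 + d)) ^ (j + 1)
      = ((n : ℝ) ^ (1 / 2 + d)) ^ (r + 1) * ((n : ℝ) ^ (1 / 2 + d)) ^ (j - r) := by
    rw [← pow_add]
    congr 1
    omega
  rw [normalizedMoment, hpow]
  ring

theorem mul_integral_eq_normalizedMoment {n : ℕ} (hn : 0 < n) {k : ℕ} {s : ℝ}
    (hs : s = (1 / 2 + d) * k) :
    (n : ℝ) ^ (-s) * ∫ ω, partialSum X n ω ^ k ∂P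
      = (k.factorial : ℝ) * normalizedMoment P X d n k := by
  have hn' : (0 : ℝ) < n := by exact_mod_cast hn
  rw [normalizedMoment, ← Real.rpow_natCast ((n : ℝ) ^ (1 / 2 + d)), ← Real.rpow_mul hn'.le,
    ← hs, Real.rpow_neg hn'.le]
  have h1 : (n : ℝ) ^ s ≠ 0 := by positivity
  have h2 : (k.factorial : ℝ) ≠ 0 := by positivity
  field_simp

end Main

theorem theorem1 {Ω : Type*} [MeasurableSpace Ω] (P : Measure Ω) [IsProbabilityMeasure P]
    (a : ℕ → ℝ) (ε : ℤ → Ω → ℝ) (X : ℕ → Ω → ℝ) (σ d c : ℝ) (k : ℕ)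
    (hε : IsIIDWhiteNoise P ε σ)
    (hX : IsLinearProcess P a ε X)
    (hd : HasMemory a d c)
    (hk : MemLp (ε 1) (k : ℝ≥0∞) P) :
    -- the expectations and the integrals in the claim exist
    (∀ n : ℕ, Integrable (fun ω => partialSum X n ω ^ k) P) ∧
    IntegrableOn (fun x : ℝ => ((1 + x) ^ d - x ^ d) ^ 2) (Set.Ioi 0) ∧
    IntegrableOn (fun x : ℝ => ((1 + x) ^ d - x ^ d) ^ 3) (Set.Ioi 0) ∧
    -- even orders
    (∀ p : ℕ, k = 2 * p →
      Tendsto (fun n : ℕ =>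
          (n : ℝ) ^ (-((p : ℝ) * (1 + 2 * d))) * ∫ ω, partialSum X n ω ^ k ∂P) atTop
        (𝓝 (memoryConst a d c ^ k * σ ^ k
          * ((k.factorial : ℝ) / (2 ^ p * (p.factorial : ℝ)))
          * integralFactor d 2 ^ p))) ∧
    -- odd orders
    (∀ l : ℕ, k = 3 + 2 * l →
      Tendsto (fun n : ℕ =>
          √(n : ℝ) * (n : ℝ) ^ (-((k : ℝ) / 2 * (1 + 2 * d)))
            * ∫ ω, partialSum X n ω ^ k ∂P) atTop
        (𝓝 (memoryConst a d c ^ k * (∫ ω, ε 1 ω ^ 3 ∂P) * σ ^ (k - 3)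
          * ((3 + 2 * l).choose 3 : ℝ)
          * (((2 * l).factorial : ℝ) / (2 ^ l * (l.factorial : ℝ)))
          * integralFactor d 3 * integralFactor d 2 ^ l))) := by
  have hd0 := hd.nonneg
  have hd2 := hd.lt_half
  -- raising the order to `K ≥ 2` costs nothing, as second moments exist anyway
  set K := max k 2 with hKdef
  have hkK : k ≤ K := le_max_left _ _
  have hK2 : 2 ≤ K := le_max_right _ _
  have hK : MemLp (ε 1) (K : ℝ≥0∞) P := by
    rcases le_total k 2 with h | h
    · rw [hKdef, max_eq_right h]; exact_mod_cast hε.memLp_two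
    · rw [hKdef, max_eq_left h]; exact hk
  refine ⟨fun n => integrable_pow_of_memLp (tendsto_eLpNorm_partialSum hε hX hK hK2 n).1 hkK,
    integrableOn_kernel_pow hd0 hd2 le_rfl, integrableOn_kernel_pow hd0 hd2 (by norm_num), ?_⟩
  set μ : ℕ → ℝ := fun s => ∫ ω, ε 1 ω ^ s ∂P with hμ
  have hμ0 : μ 0 = 1 := by simp [hμ]
  have hμ1 : μ 1 = 0 := by simpa [hμ] using hε.mean_zero
  have hμ2 : μ 2 = σ ^ 2 := by
    rw [← hε.variance_eq, variance_of_integral_eq_zero hε.memLp_two.1.aemeasurable hε.mean_zero]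
  have hℓ0 : logDerivCoeff μ 0 = 0 := by rw [logDerivCoeff_zero μ hμ0, hμ1]
  have hℓ1 : logDerivCoeff μ 1 = σ ^ 2 := by rw [logDerivCoeff_one μ hμ0 hμ1, hμ2]
  have hℓ2 : logDerivCoeff μ 2 = μ 3 / 2 := logDerivCoeff_two μ hμ0 hμ1
  set m := memoryConst a d c
  set q : ℕ → ℕ → ℝ := fun n r =>
    (∑' N, windowSum a n N ^ r) / ((n : ℝ) ^ (1 / 2 + d)) ^ r with hq
  have he0 : ∀ n, normalizedMoment P X d n 0 = 1 := fun n => by simp [normalizedMoment]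
  have hrec : ∀ j, j + 1 ≤ K → ∀ᶠ n in atTop,
      ((j : ℝ) + 1) * normalizedMoment P X d n (j + 1) = ∑ r ∈ Finset.range (j + 1),
        (logDerivCoeff μ r * q n (r + 1)) * normalizedMoment P X d n (j - r) :=
    fun j hj => Eventually.of_forall fun n => normalizedMoment_recursion hε hX hK hK2 d n hj
  have hq2 : Tendsto (fun n => q n 2) atTop (𝓝 (m ^ 2 * integralFactor d 2)) := by
    have := tendsto_powerSum_normalized hd hX.summable_sq (r := 2) le_rfl (s := 0) (L := 1)
      (by norm_num)
    simpa [hq] using this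
  have hq3 : ∀ r, 3 ≤ r → Tendsto (fun n => q n r) atTop (𝓝 0) := by
    intro r hr
    have hr' : (3 : ℝ) ≤ r := by exact_mod_cast hr
    have := tendsto_powerSum_normalized hd hX.summable_sq (r := r) (by omega) (s := 0)
      (tendsto_natCast_rpow_of_neg (by linarith))
    simpa [hq] using this
  have hw3 : Tendsto (fun n : ℕ => (n : ℝ) ^ (1 / 2 : ℝ) * q n 3) atTop
      (𝓝 (m ^ 3 * integralFactor d 3)) := by
    have := tendsto_powerSum_normalized hd hX.summable_sq (r := 3) (by norm_num) (s := 1 / 2)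
      (L := 1) (by norm_num)
    simpa [hq] using this
  have hw4 : ∀ r, 4 ≤ r → Tendsto (fun n : ℕ => (n : ℝ) ^ (1 / 2 : ℝ) * q n r) atTop (𝓝 0) := by
    intro r hr
    have hr' : (4 : ℝ) ≤ r := by exact_mod_cast hr
    have := tendsto_powerSum_normalized hd hX.summable_sq (r := r) (by omega) (s := 1 / 2)
      (tendsto_natCast_rpow_of_neg (by linarith))
    simpa [hq] using this
  constructor
  · rintro p rfl
    have h1 := (tendsto_of_recursion hℓ0 he0 hrec hq2 hq3 (2 * p) hkK).const_mul
      (((2 * p).factorial : ℝ))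
    rw [if_pos (by simp), show 2 * p / 2 = p by omega, hℓ1] at h1
    have hval : m ^ (2 * p) * σ ^ (2 * p) * (((2 * p).factorial : ℝ) / (2 ^ p * (p.factorial : ℝ)))
        * integralFactor d 2 ^ p = ((2 * p).factorial : ℝ) *
          ((σ ^ 2 * (m ^ 2 * integralFactor d 2) / 2) ^ p / (p.factorial : ℝ)) := by
      rw [div_pow, mul_pow, mul_pow, ← pow_mul, ← pow_mul]
      field_simp
    rw [hval]
    refine h1.congr' ?_
    filter_upwards [eventually_gt_atTop 0] with n hn
    exact (mul_integral_eq_normalizedMoment hn (by push_cast; ring)).symm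
  · rintro l rfl
    have h1 := (tendsto_mul_odd_of_recursion hℓ0 he0 hrec hq2 hq3 hw3 hw4 l hkK).const_mul
      (((3 + 2 * l).factorial : ℝ))
    rw [hℓ1, hℓ2] at h1
    have hval : m ^ (3 + 2 * l) * (∫ ω, ε 1 ω ^ 3 ∂P) * σ ^ (3 + 2 * l - 3)
        * ((3 + 2 * l).choose 3 : ℝ) * (((2 * l).factorial : ℝ) / (2 ^ l * (l.factorial : ℝ)))
        * integralFactor d 3 * integralFactor d 2 ^ l = ((3 + 2 * l).factorial : ℝ) *
          (μ 3 / 2 * (m ^ 3 * integralFactor d 3) / 3 *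
            ((σ ^ 2 * (m ^ 2 * integralFactor d 2) / 2) ^ l / (l.factorial : ℝ))) := by
      rw [Nat.cast_add_choose, Nat.add_sub_cancel_left, div_pow, mul_pow, mul_pow, ← pow_mul,
        ← pow_mul, pow_add]
      simp only [hμ]
      have h3 : ((3 : ℕ).factorial : ℝ) = 6 := by norm_num [Nat.factorial]
      rw [h3]
      have : ((2 * l).factorial : ℝ) ≠ 0 := by positivity
      field_simp
      ring
    rw [hval]
    refine h1.congr' ?_
    filter_upwards [eventually_gt_atTop 0] with n hn
    rw [Real.sqrt_eq_rpow, mul_assoc, mul_integral_eq_normalizedMoment hn (d := d) (by ring)]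
    ring
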